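/- **Setting.** Let $G=(V,E)$ be a countable, locally finite simple graph. A *subgraph* of $G$ is a set of vertices together with a set of edges between them. For a finite subgraph $H$ of $G$, let $\partial H$ be the set of vertices of $H$ incident to an edge of $G$ not belonging to $H$. For an equivalence relation $\phi$ on $\partial H$ and a subgraph $H'\subseteq H$, let $H'/\phi$ be the multigraph obtained from $H'$ by identifying the vertices of $V[H']\cap\partial H$ that are equivalent under $\phi$. Let $\mathcal F(H,\phi)$ be the set of spanning forests $F$ of $H$ such that $F/\phi$ has no cycle (loops and pairs of parallel edges count as cycles), and let $\mathcal F_T(H,\phi)$ be the set of those $F\in\mathcal F(H,\phi)$ to which no edge of $H$ can be added without leaving $\mathcal F(H,\phi)$. For $\beta\in[0,\infty)$ let $\mathbb P^\phi_{H,\beta}$ be the probability measure on $\mathcal F(H,\phi)$ giving each $F$ mass proportional to $\beta^{|F|}$, where $|F|$ is the number of edges of $F$ and $0^0=1$; let $\mathbb P^\phi_{H,\infty}$ be the uniform measure on $\mathcal F_T(H,\phi)$. An *augmented subgraph* of $G$ is a pair $(S,\Phi)$ of a subgraph $S$ of $G$ and a family $\Phi=(\Phi(H))$, indexed by the finite subgraphs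 $H$ of $G$, of equivalence relations $\Phi(H)$ on $\partial H$, such that for all finite subgraphs $H\subseteq K$ and all $u,v\in\partial H$, $u$ and $v$ are related in $\Phi(H)$ if and only if they are connected in $((S\cap K)\setminus E[H])/\Phi(K)$ (a vertex not in a subgraph is connected in it to no other vertex). The space of augmented subgraphs carries the Borel $\sigma$-algebra of the product topology. For $u\neq v$, write $u\leftrightarrow v$ if $u$ and $v$ are related in $\Phi(\{u,v\})$, where $\{u,v\}$ denotes the subgraph with these two vertices and no edges; also $u\leftrightarrow u$ for every $u$. For $\beta\in[0,\infty]$, an *augmented $\beta$-arboreal gas Gibbs measure* on $G$ is the law of a random augmented subgraph $(A,\Phi)$ such that for every finite subgraph $H$, the conditional law of $A\cap H$ given the $\sigma$-algebra generated by $A\setminus E[H]$ and $(\Phi(K): K\supseteq H \text{ finite})$ is almost surely $\mathbb P^{\Phi(H)}_{H,\beta}$. A *$\beta$-arboreal gas Gibbs measure* on $G$ is a probability measure on the set of spanning forests of $G$ that is the law of $A$ for some such $(A,\Phi)$; for $\beta=\infty$ it is called a *uniform maximal spanning forest Gibbs measure*. **Proposition.** Let $G=(V,E)$ be a connected, locally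 finite graph, let $o\in V$, let $\beta\in[0,\infty]$, and let $(A,\Phi)$ be distributed as an augmented $\beta$-arboreal gas Gibbs measure on $G$. Let $I_o=\{x\in V: o\leftrightarrow x\}$, and for $I\subseteq V$ let $\mathrm{Tr}(I)$ be the subgraph of $G$ induced by $I$. Then the conditional distribution of the restriction of $A$ to $\mathrm{Tr}(I_o)$, given $I_o$ and the restriction of $A$ to $\mathrm{Tr}(V\setminus I_o)$, is almost surely equal to some uniform maximal spanning forest Gibbs measure on the graph $\mathrm{Tr}(I_o)$, where the choice of Gibbs measure may be random (that is, it may depend on $I_o$ and on the restriction of $A$ to $\mathrm{Tr}(V\setminus I_o)$). -/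

import Mathlib

open MeasureTheory ProbabilityTheory
open scoped ENNReal

namespace ArborealGas

universe u

variable {V : Type u} {G : SimpleGraph V}

/-- The finite subgraphs of `G`. A subgraph is a set of vertices together with a set of edges. -/
abbrev FinSub (G : SimpleGraph V) : Type u := {H : G.Subgraph // H.verts.Finite}

/-- The inner vertex boundary of `H`: the vertices of `H` that are incident to an edge of `G` that
does not belong to `H`. -/
def bdry (H : G.Subgraph) : Set V := {v | v ∈ H.verts ∧ ∃ w, G.Adj v w ∧ ¬ H.Adj v w}

/-- A boundary condition on `H`: an equivalence relation on the boundary of `H`. -/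
abbrev BdryCond (H : G.Subgraph) : Type u := Setoid (bdry H)

/-- A boundary condition viewed as a relation between vertices of `G`. -/
def bcRel {H : G.Subgraph} (φ : BdryCond H) (u v : V) : Prop :=
  ∃ (hu : u ∈ bdry H) (hv : v ∈ bdry H), φ ⟨u, hu⟩ ⟨v, hv⟩

/-- `u` and `v` are connected in `T / φ`, the graph obtained from `T` by identifying those vertices
of `T` that are equivalent under `φ`. A vertex not in `T` is connected to no other vertex. -/
def ConnMod (T : G.Subgraph) {H : G.Subgraph} (φ : BdryCond H) (u v : V) : Prop :=
  Relation.EqvGen (fun a b => T.Adj a b ∨ (a ∈ T.verts ∧ b ∈ T.verts ∧ bcRel φ a b)) u v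

/-- The subgraph `T` with the edges of `H` removed (all vertices of `T` are kept). -/
def minusEdges (T H : G.Subgraph) : G.Subgraph := T.deleteEdges H.edgeSet

/-- `F` is a spanning forest of `H`. -/
def IsSpanningForest (H F : G.Subgraph) : Prop :=
  F ≤ H ∧ F.verts = H.verts ∧ F.coe.IsAcyclic

/-- The multigraph `F / φ` is acyclic: no edge of `F` has its two endpoints connected in
`(F ∖ e) / φ`. In particular an edge whose endpoints are identified (a loop of `F / φ`) and a pair
of edges that become parallel both count as cycles. -/
def AcyclicMod (F : G.Subgraph) {H : G.Subgraph} (φ : BdryCond H) : Prop :=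
  ∀ u v, F.Adj u v → ¬ ConnMod (F.deleteEdges {s(u, v)}) φ u v

/-- The spanning forests of `H` that extend `φ`. -/
def forests (H : G.Subgraph) (φ : BdryCond H) : Set G.Subgraph :=
  {F | IsSpanningForest H F ∧ AcyclicMod F φ}

/-- The maximal spanning forests: no edge of `H` can be added to yield another
element of `forests H φ`. -/
def maxForests (H : G.Subgraph) (φ : BdryCond H) : Set G.Subgraph :=
  {F | F ∈ forests H φ ∧ ∀ u v, ∀ h : H.Adj u v, ¬ F.Adj u v →
    F ⊔ G.subgraphOfAdj (H.adj_sub h) ∉ forests H φ}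

open Classical in
/-- The mass that the finite-volume `β`-arboreal gas Gibbs measure on the finite subgraph `H` with
boundary condition `φ` gives to `F`. -/
noncomputable def gibbsMass (β : ℝ≥0∞) (H : G.Subgraph) (φ : BdryCond H) (F : G.Subgraph) : ℝ :=
  if β = ∞ then
    (if F ∈ maxForests H φ then ((maxForests H φ).ncard : ℝ)⁻¹ else 0)
  else
    (if F ∈ forests H φ then
      β.toReal ^ F.edgeSet.ncard / ∑ᶠ F' ∈ forests H φ, β.toReal ^ F'.edgeSet.ncard
    else 0)

/-- The augmented subgraphs `(S, Φ)` of `G`. -/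
@[ext]
structure AugSubgraph (G : SimpleGraph V) where
  /-- the underlying subgraph `S` -/
  sub : G.Subgraph
  /-- the boundary map `Φ` -/
  bd : (H : FinSub G) → BdryCond H.1
  /-- the consistency condition -/
  con : ∀ H K : FinSub G, H.1 ≤ K.1 → ∀ u v : bdry H.1,
    bd H u v ↔ ConnMod (minusEdges (sub ⊓ K.1) H.1) (bd K) u v

/-- The subgraph with vertices `u` and `v` and no edges. -/
def pairSub (G : SimpleGraph V) (u v : V) : FinSub G :=
  ⟨{ verts := {u, v}
     Adj := fun _ _ => False
     adj_sub := fun h => h.elim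
     edge_vert := fun h => h.elim
     symm := ⟨fun _ _ h => h⟩ }, Set.toFinite {u, v}⟩

/-- The augmented connectivity relation. (The clause `u = v` is only needed when `u` is isolated
in `G`, so that it does not lie in the boundary of `{u, v}`.) -/
def AugConn (ω : AugSubgraph G) (u v : V) : Prop :=
  u = v ∨ bcRel (ω.bd (pairSub G u v)) u v

/-- The augmented connectivity class of `o`. -/
def augClass (o : V) (ω : AugSubgraph G) : Set V := {x | AugConn ω o x}

/-- The product sigma-algebra on subgraphs, generated by the events that a given vertex, or a given
edge, is present. For a countable graph it is the Borel sigma-algebra of the product topology. -/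
instance instMeasurableSpaceSubgraph : MeasurableSpace G.Subgraph :=
  MeasurableSpace.generateFrom
    ({s | ∃ v : V, s = {S : G.Subgraph | v ∈ S.verts}} ∪
      {s | ∃ u v : V, s = {S : G.Subgraph | S.Adj u v}})

/-- The sigma-algebra on boundary conditions generated by the events that two given boundary
vertices are related. For finite `H` it consists of all sets. -/
instance instMeasurableSpaceBdryCond (H : G.Subgraph) : MeasurableSpace (BdryCond H) :=
  MeasurableSpace.generateFrom {s | ∃ u v : bdry H, s = {φ : BdryCond H | φ u v}}

/-- The product sigma-algebra on augmented subgraphs. For a countable, locally finite graph it is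
the Borel sigma-algebra of the product topology. -/
instance instMeasurableSpaceAugSubgraph : MeasurableSpace (AugSubgraph G) :=
  MeasurableSpace.comap AugSubgraph.sub inferInstance ⊔
    ⨆ H : FinSub G, MeasurableSpace.comap (fun ω : AugSubgraph G => ω.bd H) inferInstance

/-- The sigma-algebra of the outside of `H`, generated by `A ∖ E[H]` and by all `Φ(K)` with `K` a
finite subgraph of `G` that contains `H`. -/
@[reducible]
def outside (H : FinSub G) : MeasurableSpace (AugSubgraph G) :=
  MeasurableSpace.comap (fun ω : AugSubgraph G => minusEdges ω.sub H.1) inferInstance ⊔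
    ⨆ K : {K : FinSub G // H.1 ≤ K.1},
      MeasurableSpace.comap (fun ω : AugSubgraph G => ω.bd K.1) inferInstance

theorem measurableSet_adj (u v : V) : MeasurableSet {S : G.Subgraph | S.Adj u v} :=
  MeasurableSpace.measurableSet_generateFrom (Or.inr ⟨u, v, rfl⟩)

theorem measurable_minusEdges (H : G.Subgraph) :
    Measurable (fun S : G.Subgraph => minusEdges S H) := by
  refine measurable_generateFrom ?_
  rintro t (⟨v, rfl⟩ | ⟨u, v, rfl⟩)
  · exact MeasurableSpace.measurableSet_generateFrom (Or.inl ⟨v, rfl⟩)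
  · by_cases h : H.Adj u v
    · convert MeasurableSet.empty using 1
      ext S
      simp [minusEdges, h]
    · have := measurableSet_adj (G := G) u v
      convert this using 1
      refine Set.ext fun S => ?_
      simp [minusEdges, h]

/-- `outside H` is a sub-sigma-algebra, so that conditioning on it makes sense. -/
theorem outside_le (H : FinSub G) : outside H ≤ instMeasurableSpaceAugSubgraph := by
  refine sup_le ?_ (iSup_le fun K => ?_)
  · rintro s ⟨t, ht, rfl⟩
    exact (le_sup_left : _ ≤ instMeasurableSpaceAugSubgraph (G := G)) _
      ⟨_, measurable_minusEdges H.1 ht, rfl⟩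
  · exact (le_iSup (fun K : FinSub G => MeasurableSpace.comap
      (fun ω : AugSubgraph G => ω.bd K) inferInstance) K.1).trans le_sup_right

/-- `Q` is an augmented `β`-arboreal gas Gibbs measure on `G`: for each finite subgraph `H`, the
conditional law of `A ∩ H` given the outside of `H` is almost surely the finite-volume Gibbs
measure on `H` with boundary condition `Φ(H)`. -/
def IsAugGibbs (G : SimpleGraph V) (β : ℝ≥0∞) (Q : Measure (AugSubgraph G)) : Prop :=
  IsProbabilityMeasure Q ∧
    ∀ (H : FinSub G) (F : G.Subgraph),
      Q[Set.indicator {ω : AugSubgraph G | ω.sub ⊓ H.1 = F} (fun _ => (1 : ℝ)) | outside H]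
        =ᵐ[Q] fun ω => gibbsMass β H.1 (ω.bd H) F

/-- `P` is a `β`-arboreal gas Gibbs measure on `G`: it is a probability measure on spanning forests
of `G` and it is the law of `A` under some augmented `β`-arboreal gas Gibbs measure. -/
def IsGibbs (G : SimpleGraph V) (β : ℝ≥0∞) (P : Measure G.Subgraph) : Prop :=
  IsProbabilityMeasure P ∧ (∀ᵐ S ∂P, IsSpanningForest ⊤ S) ∧
    ∃ Q : Measure (AugSubgraph G), IsAugGibbs G β Q ∧ Q.map AugSubgraph.sub = P

/-- Gibbs measures for the uniform maximal spanning forest (uniform spanning tree) on `G`. -/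
def IsUMSFGibbs (G : SimpleGraph V) (P : Measure G.Subgraph) : Prop := IsGibbs G ∞ P

/-- The restriction of `S` to the vertex set `I`, as a subgraph of `G`. -/
def restr (S : G.Subgraph) (I : Set V) : G.Subgraph := S ⊓ (⊤ : G.Subgraph).induce I

/-- The restriction of `S` to the vertex set `I`, as a subgraph of the graph induced by `I`. -/
def restrInd (I : Set V) (S : G.Subgraph) : (G.induce I).Subgraph :=
  S.comap (SimpleGraph.Embedding.induce I).toHom

end ArborealGas

namespace ArborealGas

variable {V : Type*} {G : SimpleGraph V}

theorem bcRel.symm {H : G.Subgraph} {φ : BdryCond H} {a b : V} (h : bcRel φ a b) :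
    bcRel φ b a := by
  obtain ⟨ha, hb, h⟩ := h
  exact ⟨hb, ha, φ.symm' h⟩

/-- `a` and `b` are adjacent in `T`, or are vertices of `T` identified by `φ`. -/
def Step (T : G.Subgraph) {H : G.Subgraph} (φ : BdryCond H) (a b : V) : Prop :=
  T.Adj a b ∨ (a ∈ T.verts ∧ b ∈ T.verts ∧ bcRel φ a b)

section ConnMod

variable {T T' H : G.Subgraph} {φ : BdryCond H} {x y z : V}

theorem Step.symm (h : Step T φ x y) : Step T φ y x := by
  rcases h with h | ⟨hx, hy, h⟩
  · exact Or.inl h.symm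
  · exact Or.inr ⟨hy, hx, h.symm⟩

theorem Step.mono (hT : T ≤ T') (h : Step T φ x y) : Step T' φ x y := by
  rcases h with h | ⟨hx, hy, h⟩
  · exact Or.inl (hT.2 h)
  · exact Or.inr ⟨hT.1 hx, hT.1 hy, h⟩

theorem Step.connMod (h : Step T φ x y) : ConnMod T φ x y := .rel _ _ h

theorem ConnMod.refl (x : V) : ConnMod T φ x x := Relation.EqvGen.refl _

theorem ConnMod.symm (h : ConnMod T φ x y) : ConnMod T φ y x :=
  Relation.EqvGen.symm _ _ h

theorem ConnMod.trans (h : ConnMod T φ x y) (h' : ConnMod T φ y z) : ConnMod T φ x z :=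
  Relation.EqvGen.trans _ _ _ h h'

theorem ConnMod.le {R : V → V → Prop} (hR : Equivalence R) (hs : ∀ a b, Step T φ a b → R a b)
    (h : ConnMod T φ x y) : R x y := by
  induction h with
  | rel a b h => exact hs a b h
  | refl => exact hR.refl _
  | symm a b _ ih => exact hR.symm ih
  | trans a b c _ _ h1 h2 => exact hR.trans h1 h2

theorem ConnMod.mono (hT : T ≤ T') (h : ConnMod T φ x y) : ConnMod T' φ x y :=
  h.le ⟨ConnMod.refl, ConnMod.symm, ConnMod.trans⟩ fun _ _ hs => (hs.mono hT).connMod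

theorem ConnMod.induction {P : V → Prop} (h0 : P x)
    (hs : ∀ a b, Step T φ a b → P a → P b) (h : ConnMod T φ x y) : P y :=
  (h.le (R := fun a b => P a ↔ P b) ⟨fun _ => Iff.rfl, Iff.symm, Iff.trans⟩
    fun a b hab => ⟨hs a b hab, hs b a hab.symm⟩).1 h0

theorem ConnMod.exists_step (h : ConnMod T φ x y) (hne : x ≠ y) : ∃ z, Step T φ x z := by
  have : y = x ∨ ∃ z, Step T φ x z := by
    refine h.induction (P := fun y => y = x ∨ ∃ z, Step T φ x z) (Or.inl rfl) fun a b hab ha => ?_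
    rcases ha with rfl | ha
    · exact Or.inr ⟨b, hab⟩
    · exact Or.inr ha
  exact this.resolve_left fun h => hne h.symm

theorem Step.mem_verts (h : Step T φ x y) : x ∈ T.verts := by
  rcases h with h | ⟨h, -⟩
  · exact T.edge_vert h
  · exact h

theorem ConnMod.mem_verts (h : ConnMod T φ x y) (hne : x ≠ y) : x ∈ T.verts := by
  obtain ⟨z, hz⟩ := h.exists_step hne
  exact hz.mem_verts

end ConnMod

theorem minusEdges_adj {T H : G.Subgraph} {u v : V} :
    (minusEdges T H).Adj u v ↔ T.Adj u v ∧ ¬ H.Adj u v := by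
  simp [minusEdges]

theorem minusEdges_anti {T E H : G.Subgraph} (h : E ≤ H) : minusEdges T H ≤ minusEdges T E := by
  refine ⟨le_rfl, fun a b hab => ?_⟩
  rw [minusEdges_adj] at hab ⊢
  exact ⟨hab.1, fun h' => hab.2 (h.2 h')⟩

theorem minusEdges_mono {T T' E : G.Subgraph} (h : T ≤ T') : minusEdges T E ≤ minusEdges T' E := by
  refine ⟨h.1, fun a b hab => ?_⟩
  rw [minusEdges_adj] at hab ⊢
  exact ⟨h.2 hab.1, hab.2⟩

theorem minusEdges_bot (T : G.Subgraph) : minusEdges T ⊥ = T := by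
  ext
  · rfl
  · simp [minusEdges_adj]

/-- Connectivity in `((S ∩ K) ∖ E) / Φ(K)`. -/
def ConnIn (ω : AugSubgraph G) (E : G.Subgraph) (K : FinSub G) (x y : V) : Prop :=
  ConnMod (minusEdges (ω.sub ⊓ K.1) E) (ω.bd K) x y

section ConnIn

variable {ω : AugSubgraph G} {E : G.Subgraph} {H K : FinSub G} {x y z : V}

theorem ConnIn.symm (h : ConnIn ω E K x y) : ConnIn ω E K y x := ConnMod.symm h

theorem ConnIn.trans (h : ConnIn ω E K x y) (h' : ConnIn ω E K y z) : ConnIn ω E K x z :=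
  ConnMod.trans h h'

theorem bcRel_bd_iff (hHK : H.1 ≤ K.1) (hx : x ∈ bdry H.1) (hy : y ∈ bdry H.1) :
    bcRel (ω.bd H) x y ↔ ConnIn ω H.1 K x y :=
  ⟨fun ⟨hu, hv, h⟩ => (ω.con H K hHK ⟨x, hu⟩ ⟨y, hv⟩).1 h,
    fun h => ⟨hx, hy, (ω.con H K hHK ⟨x, hx⟩ ⟨y, hy⟩).2 h⟩⟩

theorem ConnIn.mem_bdry (hHK : H.1 ≤ K.1) (hx : x ∈ H.1.verts) (h : ConnIn ω H.1 K x y)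
    (hne : x ≠ y) : x ∈ bdry H.1 := by
  obtain ⟨z, hz | ⟨-, -, hz⟩⟩ := ConnMod.exists_step h hne
  · rw [minusEdges_adj] at hz
    exact ⟨hx, z, ω.sub.adj_sub hz.1.1, hz.2⟩
  · obtain ⟨⟨-, w, hw, hw'⟩, -⟩ := hz
    exact ⟨hx, w, hw, fun h => hw' (hHK.2 h)⟩

theorem ConnIn.bcRel_of_ne (hHK : H.1 ≤ K.1) (hx : x ∈ H.1.verts) (hy : y ∈ H.1.verts)
    (h : ConnIn ω H.1 K x y) (hne : x ≠ y) : bcRel (ω.bd H) x y :=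
  (bcRel_bd_iff hHK (h.mem_bdry hHK hx hne) (h.symm.mem_bdry hHK hy hne.symm)).2 h

theorem mem_sub_of_bcRel (h : bcRel (ω.bd H) x y) (hne : x ≠ y) : x ∈ ω.sub.verts := by
  have h' := (bcRel_bd_iff le_rfl h.1 h.2.1).1 h
  exact (ConnMod.mem_verts h' hne).1

theorem ConnIn.mono_right (hEH : E ≤ H.1) (hHK : H.1 ≤ K.1) (h : ConnIn ω E H x y) :
    ConnIn ω E K x y := by
  refine ConnMod.le ⟨ConnMod.refl, ConnMod.symm, ConnMod.trans⟩ (fun a b hab => ?_) h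
  rcases hab with hab | ⟨-, -, hab⟩
  · exact Step.connMod (Or.inl ((minusEdges_mono (inf_le_inf_left _ hHK)).2 hab))
  · exact ConnMod.mono (minusEdges_anti hEH) ((bcRel_bd_iff hHK hab.1 hab.2.1).1 hab)

theorem ConnIn.anti (hEH : E ≤ H.1) (h : ConnIn ω H.1 K x y) : ConnIn ω E K x y :=
  ConnMod.mono (minusEdges_anti hEH) h

theorem ConnIn.of_outer (hHK : H.1 ≤ K.1) (hx : x ∈ H.1.verts) (hy : y ∈ H.1.verts)
    (h : ConnIn ω H.1 K x y) : ConnIn ω E H x y := by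
  by_cases hne : x = y
  · subst hne
    exact ConnMod.refl _
  · have hb := h.bcRel_of_ne hHK hx hy hne
    exact Step.connMod (Or.inr ⟨⟨mem_sub_of_bcRel hb hne, hx⟩,
      ⟨mem_sub_of_bcRel hb.symm (Ne.symm hne), hy⟩, hb⟩)

/-- A path in `K` off `E` either avoids the edges of `H`, or decomposes into a part up to its first
visit of `H`, a part that can be realized in `H`, and a part after its last visit. -/
theorem ConnIn.excursion (hHK : H.1 ≤ K.1) (h : ConnIn ω E K x z) :
    ConnIn ω H.1 K x z ∨ ∃ w ∈ H.1.verts, ∃ w' ∈ H.1.verts,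
      ConnIn ω H.1 K x w ∧ ConnIn ω E H w w' ∧ ConnIn ω H.1 K w' z := by
  refine ConnMod.induction (P := fun z => ConnIn ω H.1 K x z ∨ ∃ w ∈ H.1.verts, ∃ w' ∈ H.1.verts,
      ConnIn ω H.1 K x w ∧ ConnIn ω E H w w' ∧ ConnIn ω H.1 K w' z)
    (Or.inl (ConnMod.refl _)) (fun a b hab ih => ?_) h
  by_cases hH : (minusEdges (ω.sub ⊓ K.1) E).Adj a b ∧ H.1.Adj a b
  · obtain ⟨h1, h2⟩ := hH
    have ha := H.1.edge_vert h2
    have hb := H.1.edge_vert h2.symm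
    have hst : ConnIn ω E H a b := by
      rw [minusEdges_adj] at h1
      exact Step.connMod (Or.inl (minusEdges_adj.2 ⟨⟨h1.1.1, h2⟩, h1.2⟩))
    rcases ih with ih | ⟨w, hw, w', hw', h3, h4, h5⟩
    · exact Or.inr ⟨a, ha, b, hb, ih, hst, ConnMod.refl _⟩
    · exact Or.inr ⟨w, hw, b, hb, h3, (h4.trans (h5.of_outer hHK hw' ha)).trans hst,
        ConnMod.refl _⟩
  · have hst : ConnIn ω H.1 K a b := by
      refine Step.connMod ?_
      rcases hab with hab | hab
      · refine Or.inl (minusEdges_adj.2 ⟨(minusEdges_adj.1 hab).1, fun h => hH ⟨hab, h⟩⟩)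
      · exact Or.inr hab
    rcases ih with ih | ⟨w, hw, w', hw', h3, h4, h5⟩
    · exact Or.inl (ih.trans hst)
    · exact Or.inr ⟨w, hw, w', hw', h3, h4, h5.trans hst⟩

/-- Augmented connectivity does not depend on the finite subgraph in which it is computed. -/
theorem connIn_iff (hEH : E ≤ H.1) (hHK : H.1 ≤ K.1) (hx : x ∈ H.1.verts) (hy : y ∈ H.1.verts) :
    ConnIn ω E H x y ↔ ConnIn ω E K x y := by
  refine ⟨ConnIn.mono_right hEH hHK, fun h => ?_⟩
  rcases h.excursion hHK with h | ⟨w, hw, w', hw', h1, h2, h3⟩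
  · exact h.of_outer hHK hx hy
  · exact ((h1.of_outer hHK hx hw).trans h2).trans (h3.of_outer hHK hw' hy)

end ConnIn

/-- `H` with the vertices `x` and `y` added. -/
def addPair (H : FinSub G) (x y : V) : FinSub G :=
  ⟨H.1 ⊔ (pairSub G x y).1, H.2.union (pairSub G x y).2⟩

theorem le_addPair (H : FinSub G) (x y : V) : H.1 ≤ (addPair H x y).1 := le_sup_left

theorem left_mem_addPair (H : FinSub G) (x y : V) : x ∈ (addPair H x y).1.verts :=
  Or.inr (Or.inl rfl)

theorem right_mem_addPair (H : FinSub G) (x y : V) : y ∈ (addPair H x y).1.verts :=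
  Or.inr (Or.inr rfl)

theorem pairSub_le {K : G.Subgraph} {x y : V} (hx : x ∈ K.verts) (hy : y ∈ K.verts) :
    (pairSub G x y).1 ≤ K := by
  refine ⟨?_, fun a b h => h.elim⟩
  rintro a (rfl | rfl)
  · exact hx
  · exact hy

theorem addPair_le {H K : FinSub G} {x y : V} (h : H.1 ≤ K.1) (hx : x ∈ K.1.verts)
    (hy : y ∈ K.1.verts) : (addPair H x y).1 ≤ K.1 :=
  sup_le h (pairSub_le hx hy)

/-- Augmented connectivity without the edges of `H`. -/
def OutConn (ω : AugSubgraph G) (H : FinSub G) (x y : V) : Prop :=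
  ConnIn ω H.1 (addPair H x y) x y

theorem outConn_iff {ω : AugSubgraph G} {H K : FinSub G} {x y : V} (h : H.1 ≤ K.1)
    (hx : x ∈ K.1.verts) (hy : y ∈ K.1.verts) : OutConn ω H x y ↔ ConnIn ω H.1 K x y :=
  connIn_iff (le_addPair H x y) (addPair_le h hx hy) (left_mem_addPair H x y)
    (right_mem_addPair H x y)

theorem augConn_iff {ω : AugSubgraph G} {K : FinSub G} {x y : V}
    (hx : x ∈ K.1.verts) (hy : y ∈ K.1.verts) : AugConn ω x y ↔ ConnIn ω ⊥ K x y := by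
  have hpx : x ∈ (pairSub G x y).1.verts := Or.inl rfl
  have hpy : y ∈ (pairSub G x y).1.verts := Or.inr rfl
  rw [← connIn_iff (H := pairSub G x y) bot_le (pairSub_le hx hy) hpx hpy]
  constructor
  · rintro (rfl | h)
    · exact ConnMod.refl _
    · exact ((bcRel_bd_iff le_rfl h.1 h.2.1).1 h).anti bot_le
  · intro h
    by_cases hne : x = y
    · exact Or.inl hne
    · refine Or.inr (ConnIn.bcRel_of_ne (K := pairSub G x y) le_rfl hpx hpy ?_ hne)
      refine ConnMod.mono ⟨le_rfl, fun a b hab => ?_⟩ h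
      exact (minusEdges_adj.1 hab).1.2.elim

theorem AugConn.symm {ω : AugSubgraph G} {x y : V} (h : AugConn ω x y) : AugConn ω y x := by
  have hx : x ∈ (pairSub G x y).1.verts := Or.inl rfl
  have hy : y ∈ (pairSub G x y).1.verts := Or.inr rfl
  exact (augConn_iff hy hx).2 ((augConn_iff hx hy).1 h).symm

theorem AugConn.trans {ω : AugSubgraph G} {x y z : V} (h : AugConn ω x y) (h' : AugConn ω y z) :
    AugConn ω x z := by
  have hx : x ∈ (addPair (pairSub G x y) y z).1.verts := Or.inl (Or.inl rfl)
  have hy : y ∈ (addPair (pairSub G x y) y z).1.verts := Or.inl (Or.inr rfl)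
  have hz : z ∈ (addPair (pairSub G x y) y z).1.verts := Or.inr (Or.inr rfl)
  exact (augConn_iff hx hz).2 (((augConn_iff hx hy).1 h).trans ((augConn_iff hy hz).1 h'))

theorem augConn_of_adj {ω : AugSubgraph G} {x y : V} (h : ω.sub.Adj x y) : AugConn ω x y := by
  let K : FinSub G := ⟨G.subgraphOfAdj (ω.sub.adj_sub h), Set.toFinite {x, y}⟩
  have hK : K.1.Adj x y := rfl
  refine (augConn_iff (K := K) (K.1.edge_vert hK) (K.1.edge_vert hK.symm)).2
    (Step.connMod (Or.inl ?_))
  rw [minusEdges_bot]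
  exact ⟨h, hK⟩

theorem OutConn.augConn {ω : AugSubgraph G} {H : FinSub G} {x y : V} (h : OutConn ω H x y) :
    AugConn ω x y :=
  (augConn_iff (left_mem_addPair H x y) (right_mem_addPair H x y)).2 (ConnIn.anti bot_le h)

theorem AugConn.outConn_or {ω : AugSubgraph G} (H : FinSub G) {x y : V} (h : AugConn ω x y) :
    OutConn ω H x y ∨ ∃ w ∈ H.1.verts, ∃ w' ∈ H.1.verts, OutConn ω H x w ∧ OutConn ω H w' y := by
  have hx := left_mem_addPair H x y
  have hy := right_mem_addPair H x y
  have hH := le_addPair H x y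
  rcases ((augConn_iff hx hy).1 h).excursion hH with h | ⟨w, hw, w', hw', h1, -, h3⟩
  · exact Or.inl h
  · exact Or.inr ⟨w, hw, w', hw', (outConn_iff hH hx (hH.1 hw)).2 h1,
      (outConn_iff hH (hH.1 hw') hy).2 h3⟩

/-- `o` is connected to `H` without the edges of `H` (if `H` is nonempty). -/
def Reaches (o : V) (H : FinSub G) (ω : AugSubgraph G) : Prop :=
  H.1.verts.Nonempty → ∃ v ∈ H.1.verts, OutConn ω H o v

/-- All vertices of `H` are connected in `F / φ`. -/
def ConnAll {H : G.Subgraph} (φ : BdryCond H) (F : G.Subgraph) : Prop :=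
  ∀ u ∈ H.verts, ∀ v ∈ H.verts, ConnMod F φ u v

theorem subset_augClass_iff {o : V} {H : FinSub G} {ω : AugSubgraph G} :
    H.1.verts ⊆ augClass o ω ↔ Reaches o H ω ∧ ConnAll (ω.bd H) (ω.sub ⊓ H.1) := by
  have key : ∀ u ∈ H.1.verts, ∀ v ∈ H.1.verts,
      (AugConn ω u v ↔ ConnMod (ω.sub ⊓ H.1) (ω.bd H) u v) := fun u hu v hv => by
    rw [augConn_iff hu hv, ConnIn, minusEdges_bot]
  constructor
  · refine fun h => ⟨fun ⟨v, hv⟩ => ?_, fun u hu v hv => (key u hu v hv).1 ?_⟩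
    · rcases (h hv : AugConn ω o v).outConn_or H with h' | ⟨w, hw, w', hw', h1, h2⟩
      · exact ⟨v, hv, h'⟩
      · exact ⟨w, hw, h1⟩
    · exact (AugConn.symm (h hu)).trans (h hv)
  · rintro ⟨h1, h2⟩ v hv
    obtain ⟨w, hw, h⟩ := h1 ⟨v, hv⟩
    exact h.augConn.trans ((key w hw v hv).2 (h2 w hw v hv))

/-- The vertices connected to `o` or to `H` without the edges of `H`. -/
def outClass (o : V) (H : FinSub G) (ω : AugSubgraph G) : Set V :=
  {x | OutConn ω H o x ∨ ∃ v ∈ H.1.verts, OutConn ω H v x}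

theorem augClass_eq_outClass {o : V} {H : FinSub G} {ω : AugSubgraph G}
    (h : H.1.verts ⊆ augClass o ω) : augClass o ω = outClass o H ω := by
  ext x
  constructor
  · intro hx
    rcases (hx : AugConn ω o x).outConn_or H with h' | ⟨w, hw, w', hw', h1, h2⟩
    · exact Or.inl h'
    · exact Or.inr ⟨w', hw', h2⟩
  · rintro (hx | ⟨v, hv, hx⟩)
    · exact hx.augConn
    · exact (h hv : AugConn ω o v).trans hx.augConn

theorem restr_compl_eq {H S : G.Subgraph} {I : Set V} (h : H.verts ⊆ I) :
    restr S Iᶜ = restr (minusEdges S H) Iᶜ := by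
  ext a b
  · rfl
  · simp only [restr, SimpleGraph.Subgraph.inf_adj, minusEdges_adj,
      SimpleGraph.Subgraph.induce_adj]
    refine ⟨fun hab => ⟨⟨hab.1, fun h' => hab.2.1 (h (H.edge_vert h'))⟩, hab.2⟩,
      fun hab => ⟨hab.1.1, hab.2⟩⟩

section Forests

variable {F T T' H : G.Subgraph} {φ : BdryCond H} {a b u v : V}

theorem AcyclicMod.mono (hT : T ≤ F) (h : AcyclicMod F φ) : AcyclicMod T φ := by
  intro u v huv hc
  have hle : T.deleteEdges {s(u, v)} ≤ F.deleteEdges {s(u, v)} := by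
    refine ⟨hT.1, fun a b hab => ?_⟩
    rw [SimpleGraph.Subgraph.deleteEdges_adj] at hab ⊢
    exact ⟨hT.2 hab.1, hab.2⟩
  exact h u v (hT.2 huv) (hc.mono hle)

theorem AcyclicMod.isAcyclic_spanningCoe (h : AcyclicMod F φ) : F.spanningCoe.IsAcyclic := by
  rw [SimpleGraph.isAcyclic_iff_forall_adj_isBridge]
  intro u v huv
  rw [SimpleGraph.isBridge_iff]
  intro hr
  rw [SimpleGraph.reachable_iff_reflTransGen] at hr
  refine h u v huv ?_
  clear huv
  suffices ∀ w, Relation.ReflTransGen (F.spanningCoe.deleteEdges {s(u, v)}).Adj u w →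
      ConnMod (F.deleteEdges {s(u, v)}) φ u w from this v hr
  intro w hw
  induction hw with
  | refl => exact ConnMod.refl _
  | tail _ hbc ih =>
    refine ih.trans (Step.connMod (Or.inl ?_))
    simpa using hbc

theorem isAcyclic_coe_of_spanningCoe (h : F.spanningCoe.IsAcyclic) : F.coe.IsAcyclic :=
  h.comap F.coeEmbeddingSpanningCoe.toHom F.coeEmbeddingSpanningCoe.injective

theorem mem_forests_iff : F ∈ forests H φ ↔ F ≤ H ∧ F.verts = H.verts ∧ AcyclicMod F φ :=
  ⟨fun h => ⟨h.1.1, h.1.2.1, h.2⟩,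
    fun h => ⟨⟨h.1, h.2.1, isAcyclic_coe_of_spanningCoe h.2.2.isAcyclic_spanningCoe⟩, h.2.2⟩⟩

/-- Connectivity after adding the edge `uv`. -/
theorem connMod_add_edge (hv : T'.verts ⊆ T.verts)
    (hT : ∀ a b, T'.Adj a b → T.Adj a b ∨ s(a, b) = s(u, v)) (h : ConnMod T' φ a b) :
    ConnMod T φ a b ∨ (ConnMod T φ a u ∧ ConnMod T φ v b) ∨
      (ConnMod T φ a v ∧ ConnMod T φ u b) := by
  refine ConnMod.induction (P := fun b => ConnMod T φ a b ∨ (ConnMod T φ a u ∧ ConnMod T φ v b) ∨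
      (ConnMod T φ a v ∧ ConnMod T φ u b)) (Or.inl (ConnMod.refl _)) (fun c d hcd ih => ?_) h
  have hcd' : ConnMod T φ c d ∨ s(c, d) = s(u, v) := by
    rcases hcd with hcd | ⟨hc, hd, hcd⟩
    · exact (hT c d hcd).imp (fun h => Step.connMod (Or.inl h)) id
    · exact Or.inl (Step.connMod (Or.inr ⟨hv hc, hv hd, hcd⟩))
  rcases hcd' with hcd' | hcd'
  · rcases ih with ih | ih | ih
    · exact Or.inl (ih.trans hcd')
    · exact Or.inr (Or.inl ⟨ih.1, ih.2.trans hcd'⟩)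
    · exact Or.inr (Or.inr ⟨ih.1, ih.2.trans hcd'⟩)
  · rw [Sym2.eq_iff] at hcd'
    rcases hcd' with ⟨rfl, rfl⟩ | ⟨rfl, rfl⟩
    · rcases ih with ih | ih | ih
      · exact Or.inr (Or.inl ⟨ih, ConnMod.refl _⟩)
      · exact Or.inr (Or.inl ⟨ih.1, ConnMod.refl _⟩)
      · exact Or.inl ih.1
    · rcases ih with ih | ih | ih
      · exact Or.inr (Or.inr ⟨ih, ConnMod.refl _⟩)
      · exact Or.inl ih.1
      · exact Or.inr (Or.inr ⟨ih.1, ConnMod.refl _⟩)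

theorem AcyclicMod.sup_edge (h : AcyclicMod F φ) (huv : G.Adj u v) (hu : u ∈ F.verts)
    (hv : v ∈ F.verts) (hc : ¬ ConnMod F φ u v) :
    AcyclicMod (F ⊔ G.subgraphOfAdj huv) φ := by
  have hverts : ∀ s, ((F ⊔ G.subgraphOfAdj huv).deleteEdges s).verts ⊆ F.verts := by
    rintro s x (hx | (rfl | rfl))
    · exact hx
    · exact hu
    · exact hv
  intro a b hab hab'
  by_cases he : s(a, b) = s(u, v)
  · have hle : (F ⊔ G.subgraphOfAdj huv).deleteEdges {s(a, b)} ≤ F := by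
      refine ⟨hverts _, fun x y hxy => ?_⟩
      rw [SimpleGraph.Subgraph.deleteEdges_adj, SimpleGraph.Subgraph.sup_adj, he] at hxy
      refine hxy.1.resolve_right fun h' => hxy.2 ?_
      exact (show s(u, v) = s(x, y) from h').symm
    rw [Sym2.eq_iff] at he
    rcases he with ⟨rfl, rfl⟩ | ⟨rfl, rfl⟩
    · exact hc (hab'.mono hle)
    · exact hc (hab'.mono hle).symm
  · have habF : F.Adj a b := by
      rcases hab with hab | hab
      · exact hab
      · exact (he (show s(u, v) = s(a, b) from hab).symm).elim
    have hle : F.deleteEdges {s(a, b)} ≤ F := SimpleGraph.Subgraph.deleteEdges_le _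
    have hst : ConnMod F φ a b := Step.connMod (Or.inl habF)
    have hadd : ∀ x y, ((F ⊔ G.subgraphOfAdj huv).deleteEdges {s(a, b)}).Adj x y →
        (F.deleteEdges {s(a, b)}).Adj x y ∨ s(x, y) = s(u, v) := by
      intro x y hxy
      rw [SimpleGraph.Subgraph.deleteEdges_adj] at hxy ⊢
      rcases hxy.1 with h' | h'
      · exact Or.inl ⟨h', hxy.2⟩
      · exact Or.inr (show s(u, v) = s(x, y) from h').symm
    rcases connMod_add_edge (T := F.deleteEdges {s(a, b)}) (hverts _) hadd hab' with h' | ⟨h1, h2⟩ | ⟨h1, h2⟩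
    · exact h a b habF h'
    · exact hc (((h1.mono hle).symm.trans hst).trans (h2.mono hle).symm)
    · exact hc (((h2.mono hle).trans hst.symm).trans (h1.mono hle))

theorem mem_maxForests_iff : F ∈ maxForests H φ ↔
    F ∈ forests H φ ∧ ∀ u v, H.Adj u v → ConnMod F φ u v := by
  refine and_congr_right fun hF => ?_
  rw [mem_forests_iff] at hF
  obtain ⟨hFH, hFv, hFa⟩ := hF
  constructor
  · intro h u v huv
    by_cases hF' : F.Adj u v
    · exact Step.connMod (Or.inl hF')
    · by_contra hc
      have hu : u ∈ F.verts := hFv ▸ H.edge_vert huv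
      have hv : v ∈ F.verts := hFv ▸ H.edge_vert huv.symm
      refine h u v huv hF' (mem_forests_iff.2 ⟨sup_le hFH
        (SimpleGraph.subgraphOfAdj_le_of_adj H huv), ?_, hFa.sup_edge _ hu hv hc⟩)
      rw [SimpleGraph.Subgraph.verts_sup, ← hFv]
      refine Set.union_eq_left.2 ?_
      rintro x (rfl | rfl)
      · exact hu
      · exact hv
  · intro h u v huv hF' hmem
    refine (mem_forests_iff.1 hmem).2.2 u v (Or.inr rfl) ((h u v huv).mono
      ⟨fun x hx => Or.inl hx, fun x y hxy => ?_⟩)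
    rw [SimpleGraph.Subgraph.deleteEdges_adj]
    refine ⟨Or.inl hxy, fun he => hF' ?_⟩
    exact (SimpleGraph.Subgraph.adj_congr_of_sym2 (Set.mem_singleton_iff.1 he)).1 hxy

theorem mem_maxForests_of_connAll (hF : F ∈ forests H φ) (hc : ConnAll φ F) :
    F ∈ maxForests H φ :=
  mem_maxForests_iff.2 ⟨hF, fun u v huv => hc u (H.edge_vert huv) v (H.edge_vert huv.symm)⟩

theorem connAll_of_mem_maxForests (hT : T ∈ forests H φ) (hc : ConnAll φ T)
    (hF : F ∈ maxForests H φ) : ConnAll φ F := by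
  intro u hu v hv
  rw [mem_maxForests_iff, mem_forests_iff] at hF
  rw [mem_forests_iff] at hT
  refine (hc u hu v hv).le ⟨ConnMod.refl, ConnMod.symm, ConnMod.trans⟩ fun a b hab => ?_
  rcases hab with hab | ⟨ha, hb, hab⟩
  · exact hF.2 a b (hT.1.2 hab)
  · rw [hT.2.1, ← hF.1.2.1] at ha hb
    exact Step.connMod (Or.inr ⟨ha, hb, hab⟩)

end Forests

theorem card_quotient_merge {α : Type*} [Finite α] {s t : Setoid α} {u v : α} (huv : ¬ s u v)
    (h : ∀ a b, t a b ↔ s a b ∨ (s a u ∧ s v b) ∨ (s a v ∧ s u b)) :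
    Nat.card (Quotient s) = Nat.card (Quotient t) + 1 := by
  classical
  have hst : ∀ a b, s a b → t a b := fun a b hab => (h a b).2 (Or.inl hab)
  let f : {q : Quotient s // q ≠ Quotient.mk s v} → Quotient t :=
    fun q => Quotient.map id hst q.1
  have hf : Function.Bijective f := by
    constructor
    · rintro ⟨p, hp⟩ ⟨q, hq⟩ hpq
      induction p using Quotient.inductionOn with | h a => ?_
      induction q using Quotient.inductionOn with | h b => ?_
      have hab : t a b := Quotient.exact hpq
      refine Subtype.ext (Quotient.sound ?_)
      have ha : ¬ s a v := fun h' => hp (Quotient.sound h')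
      have hb : ¬ s b v := fun h' => hq (Quotient.sound h')
      rcases (h a b).1 hab with h' | ⟨-, h'⟩ | ⟨h', -⟩
      · exact h'
      · exact (hb (s.symm' h')).elim
      · exact (ha h').elim
    · intro q
      induction q using Quotient.inductionOn with | h a => ?_
      by_cases ha : s a v
      · refine ⟨⟨Quotient.mk s u, fun h' => huv (Quotient.exact h')⟩, Quotient.sound ?_⟩
        exact (h u a).2 (Or.inr (Or.inl ⟨s.refl' u, s.symm' ha⟩))
      · exact ⟨⟨Quotient.mk s a, fun h' => ha (Quotient.exact h')⟩, rfl⟩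
  rw [← Nat.card_eq_of_bijective f hf, ← Finite.card_option]
  exact (Nat.card_congr (Equiv.optionSubtypeNe (Quotient.mk s v))).symm

theorem finite_edgeSet {F : G.Subgraph} (h : F.verts.Finite) : F.edgeSet.Finite := by
  refine ((h.prod h).image fun p : V × V => s(p.1, p.2)).subset ?_
  intro e
  induction e using Sym2.ind with | _ a b => ?_
  exact fun hab => ⟨(a, b), ⟨F.edge_vert hab, F.edge_vert (F.symm.symm _ _ hab)⟩, rfl⟩

/-- The partition of `W` into connected components of `T / φ`. -/
def connSetoid (W : Set V) (T : G.Subgraph) {H : G.Subgraph} (φ : BdryCond H) : Setoid W :=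
  Setoid.comap Subtype.val ⟨ConnMod T φ, ConnMod.refl, ConnMod.symm, ConnMod.trans⟩

theorem exists_ncard_edgeSet_add_card {W : Set V} (hW : W.Finite) {H : G.Subgraph}
    (φ : BdryCond H) : ∃ c : ℕ, ∀ F : G.Subgraph, F.verts = W → AcyclicMod F φ →
      F.edgeSet.ncard + Nat.card (Quotient (connSetoid W F φ)) = c := by
  have := hW.to_subtype
  let B : G.Subgraph :=
    { verts := W
      Adj := fun _ _ => False
      adj_sub := fun h => h.elim
      edge_vert := fun h => h.elim
      symm := ⟨fun _ _ h => h⟩ }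
  refine ⟨Nat.card (Quotient (connSetoid W B φ)), ?_⟩
  suffices h : ∀ n, ∀ F : G.Subgraph, F.edgeSet.ncard = n → F.verts = W → AcyclicMod F φ →
      n + Nat.card (Quotient (connSetoid W F φ)) = Nat.card (Quotient (connSetoid W B φ)) from
    fun F => h _ F rfl
  intro n
  induction n with
  | zero =>
    intro F hn hF hacyc
    have hfin : F.edgeSet.Finite := finite_edgeSet (hF ▸ hW)
    rw [Set.ncard_eq_zero hfin] at hn
    have : F = B := by
      ext a b
      · rw [hF]
      · rw [← SimpleGraph.Subgraph.mem_edgeSet, hn]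
        exact Iff.rfl
    rw [this, zero_add]
  | succ n ih =>
    intro F hn hF hacyc
    have hfin : F.edgeSet.Finite := finite_edgeSet (hF ▸ hW)
    obtain ⟨e, he⟩ : F.edgeSet.Nonempty := by
      rw [← Set.ncard_pos hfin, hn]
      exact n.succ_pos
    induction e using Sym2.ind with | _ u v => ?_
    have huv : F.Adj u v := he
    have hle : F.deleteEdges {s(u, v)} ≤ F := SimpleGraph.Subgraph.deleteEdges_le _
    have hcard : (F.deleteEdges {s(u, v)}).edgeSet.ncard = n := by
      have : (F.deleteEdges {s(u, v)}).edgeSet = F.edgeSet \ {s(u, v)} := by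
        ext e
        induction e using Sym2.ind with | _ a b => ?_
        exact SimpleGraph.Subgraph.deleteEdges_adj _ _ _
      rw [this, Set.ncard_sdiff_singleton_of_mem he, hn]
      rfl
    have h1 := ih (F.deleteEdges {s(u, v)}) hcard hF (hacyc.mono hle)
    have hu : u ∈ W := hF ▸ F.edge_vert huv
    have hv : v ∈ W := hF ▸ F.edge_vert huv.symm
    rw [← h1, card_quotient_merge (s := connSetoid W (F.deleteEdges {s(u, v)}) φ)
      (t := connSetoid W F φ) (u := ⟨u, hu⟩) (v := ⟨v, hv⟩) (hacyc u v huv), add_right_comm,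
      add_assoc]
    rintro ⟨a, ha⟩ ⟨b, hb⟩
    constructor
    · intro hab
      refine connMod_add_edge (T' := F) le_rfl (fun x y hxy => ?_) hab
      rw [SimpleGraph.Subgraph.deleteEdges_adj]
      by_cases hs : s(x, y) = s(u, v)
      · exact Or.inr hs
      · exact Or.inl ⟨hxy, hs⟩
    · have hst : ConnMod F φ u v := Step.connMod (Or.inl huv)
      rintro (h' | ⟨h', h''⟩ | ⟨h', h''⟩)
      · exact ConnMod.mono hle h'
      · exact ((ConnMod.mono hle h').trans hst).trans (ConnMod.mono hle h'')
      · exact ((ConnMod.mono hle h').trans hst.symm).trans (ConnMod.mono hle h'')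

/-- All spanning trees of `H / φ` have the same number of edges. -/
theorem ncard_edgeSet_eq {H : G.Subgraph} (hH : H.verts.Finite) {φ : BdryCond H}
    {F T : G.Subgraph} (hF : F ∈ forests H φ) (hFc : ConnAll φ F) (hT : T ∈ forests H φ)
    (hTc : ConnAll φ T) : F.edgeSet.ncard = T.edgeSet.ncard := by
  obtain ⟨c, hc⟩ := exists_ncard_edgeSet_add_card hH φ
  rw [mem_forests_iff] at hF hT
  have h1 := hc F hF.2.1 hF.2.2
  have h2 := hc T hT.2.1 hT.2.2
  have : connSetoid H.verts F φ = connSetoid H.verts T φ := by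
    ext a b
    exact ⟨fun _ => hTc a a.2 b b.2, fun _ => hFc a a.2 b b.2⟩
  rw [this] at h1
  omega

theorem finite_setOf_le {H : G.Subgraph} (hH : H.verts.Finite) : {F : G.Subgraph | F ≤ H}.Finite := by
  have := hH.to_subtype
  let f : {F : G.Subgraph | F ≤ H} → Set H.verts × Set (H.verts × H.verts) :=
    fun F => ({x | x.1 ∈ F.1.verts}, {p | F.1.Adj p.1 p.2})
  refine @Set.toFinite _ _ (Finite.of_injective f ?_)
  rintro ⟨F, hF⟩ ⟨T, hT⟩ h
  obtain ⟨h1, h2⟩ := Prod.ext_iff.1 h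
  refine Subtype.ext (SimpleGraph.Subgraph.ext ?_ ?_)
  · ext x
    exact ⟨fun hx => (Set.ext_iff.1 h1 ⟨x, hF.1 hx⟩).1 hx,
      fun hx => (Set.ext_iff.1 h1 ⟨x, hT.1 hx⟩).2 hx⟩
  · ext x y
    exact ⟨fun hx => (Set.ext_iff.1 h2 (⟨x, H.edge_vert (hF.2 hx)⟩,
        ⟨y, H.edge_vert (hF.2 hx).symm⟩)).1 hx,
      fun hx => (Set.ext_iff.1 h2 (⟨x, H.edge_vert (hT.2 hx)⟩,
        ⟨y, H.edge_vert (hT.2 hx).symm⟩)).2 hx⟩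

theorem gibbsMass_nonneg (β : ℝ≥0∞) (H : G.Subgraph) (φ : BdryCond H) (F : G.Subgraph) :
    0 ≤ gibbsMass β H φ F := by
  unfold gibbsMass
  split_ifs
  · positivity
  · exact le_rfl
  · exact div_nonneg (by positivity) (finsum_nonneg fun _ => finsum_nonneg fun _ => by positivity)
  · exact le_rfl

theorem mem_forests_of_gibbsMass_ne_zero {β : ℝ≥0∞} {H : G.Subgraph} {φ : BdryCond H}
    {F : G.Subgraph} (h : gibbsMass β H φ F ≠ 0) : F ∈ forests H φ := by
  unfold gibbsMass at h
  split_ifs at h with h1 h2 h2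
  · exact h2.1
  · exact (h rfl).elim
  · exact h2
  · exact (h rfl).elim

open Classical in
/-- Conditioned on `F / φ` being connected, the finite-volume Gibbs measure is uniform on the
maximal forests. -/
theorem gibbsMass_connAll (β : ℝ≥0∞) {H : G.Subgraph} (hH : H.verts.Finite) (φ : BdryCond H)
    (F : G.Subgraph) :
    (if ConnAll φ F then gibbsMass β H φ F else 0) =
      gibbsMass ∞ H φ F * ∑ T ∈ (finite_setOf_le hH).toFinset,
        if ConnAll φ T then gibbsMass β H φ T else 0 := by
  have hzero : ∀ T, T ∉ {T | T ∈ forests H φ ∧ ConnAll φ T} →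
      (if ConnAll φ T then gibbsMass β H φ T else 0) = 0 := by
    intro T hT
    split_ifs with hc
    · by_contra h0
      exact hT ⟨mem_forests_of_gibbsMass_ne_zero h0, hc⟩
    · rfl
  by_cases hne : ∃ T₀, T₀ ∈ forests H φ ∧ ConnAll φ T₀
  swap
  · have hno : ∀ T, T ∉ {T | T ∈ forests H φ ∧ ConnAll φ T} := fun T hT => hne ⟨T, hT⟩
    rw [hzero F (hno F), Finset.sum_eq_zero fun T _ => hzero T (hno T), mul_zero]
  obtain ⟨T₀, hT₀, hc₀⟩ := hne
  have hmax : maxForests H φ = {T | T ∈ forests H φ ∧ ConnAll φ T} := by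
    ext T
    exact ⟨fun h => ⟨h.1, connAll_of_mem_maxForests hT₀ hc₀ h⟩,
      fun h => mem_maxForests_of_connAll h.1 h.2⟩
  rw [← hmax] at hzero
  have hfin : (maxForests H φ).Finite :=
    (finite_setOf_le hH).subset fun T hT => (mem_forests_iff.1 hT.1).1
  have hconst : ∀ T ∈ maxForests H φ,
      (if ConnAll φ T then gibbsMass β H φ T else 0) = gibbsMass β H φ T₀ := by
    intro T hT
    have hT' := hT
    rw [hmax] at hT'
    rw [if_pos hT'.2]
    unfold gibbsMass
    split_ifs with h1 h2 h2
    · rfl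
    · exact (h2 (mem_maxForests_of_connAll hT₀ hc₀)).elim
    · rw [ncard_edgeSet_eq hH hT'.1 hT'.2 hT₀ hc₀]
    · exact (h2 hT'.1).elim
  have hsum : (∑ T ∈ (finite_setOf_le hH).toFinset,
      if ConnAll φ T then gibbsMass β H φ T else 0) =
        (maxForests H φ).ncard * gibbsMass β H φ T₀ := by
    rw [← Finset.sum_subset (s₁ := hfin.toFinset), Finset.sum_congr rfl
      fun T hT => hconst T (hfin.mem_toFinset.1 hT), Finset.sum_const, nsmul_eq_mul,
      Set.ncard_eq_toFinset_card _ hfin]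
    · exact Set.Finite.toFinset_subset_toFinset.2 fun T hT => (mem_forests_iff.1 hT.1).1
    · exact fun T _ hT => hzero T fun h => hT (hfin.mem_toFinset.2 h)
  have hpos : ((maxForests H φ).ncard : ℝ) ≠ 0 := by
    rw [Nat.cast_ne_zero]
    exact Set.ncard_ne_zero_of_mem (mem_maxForests_of_connAll hT₀ hc₀) hfin
  rw [hsum, gibbsMass.eq_1 ∞, if_pos rfl]
  split_ifs with h1 h2 h2
  · rw [inv_mul_cancel_left₀ hpos, ← hconst F h2, if_pos h1]
  · rw [zero_mul]
    simpa [h1] using hzero F h2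
  · rw [hmax] at h2
    exact (h1 h2.2).elim
  · rw [zero_mul]

section Induce

variable {I : Set V}

/-- A subgraph of the induced graph, viewed as a subgraph of `G`. -/
def up (H : (G.induce I).Subgraph) : G.Subgraph := H.map (SimpleGraph.Embedding.induce I).toHom

variable {H F T : (G.induce I).Subgraph}

theorem up_verts : (up H).verts = Subtype.val '' H.verts := rfl

theorem mem_up_verts {x : I} : x.1 ∈ (up H).verts ↔ x ∈ H.verts :=
  Subtype.val_injective.mem_set_image

theorem up_verts_subset : (up H).verts ⊆ I := by
  rintro _ ⟨x, -, rfl⟩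
  exact x.2

theorem up_adj {x y : I} : (up H).Adj x.1 y.1 ↔ H.Adj x y := by
  constructor
  · rintro ⟨a, b, hab, ha, hb⟩
    rwa [← Subtype.val_injective ha, ← Subtype.val_injective hb]
  · exact fun h => ⟨x, y, h, rfl, rfl⟩

theorem exists_of_up_adj {a b : V} (h : (up H).Adj a b) : ∃ x y : I, x.1 = a ∧ y.1 = b :=
  ⟨⟨a, up_verts_subset ((up H).edge_vert h)⟩, ⟨b, up_verts_subset ((up H).edge_vert h.symm)⟩,
    rfl, rfl⟩

theorem restrInd_adj {S : G.Subgraph} {x y : I} : (restrInd I S).Adj x y ↔ S.Adj x y :=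
  ⟨fun h => h.2, fun h => ⟨S.adj_sub h, h⟩⟩

theorem restrInd_up : restrInd I (up H) = H := by
  ext x y
  · exact mem_up_verts
  · rw [restrInd_adj, up_adj]

theorem up_restrInd {S : G.Subgraph} (hS : S.verts ⊆ I) : up (restrInd I S) = S := by
  ext a b
  · constructor
    · rintro ⟨x, hx, rfl⟩
      exact hx
    · exact fun h => ⟨⟨a, hS h⟩, h, rfl⟩
  · constructor
    · intro h
      obtain ⟨x, y, rfl, rfl⟩ := exists_of_up_adj h
      exact restrInd_adj.1 (up_adj.1 h)
    · exact fun h => up_adj (x := ⟨a, hS (S.edge_vert h)⟩) (y := ⟨b, hS (S.edge_vert h.symm)⟩) |>.2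
        (restrInd_adj.2 h)

theorem up_injective : Function.Injective (up : (G.induce I).Subgraph → G.Subgraph) :=
  Function.LeftInverse.injective fun _ => restrInd_up

theorem up_le_iff : up F ≤ up H ↔ F ≤ H := by
  constructor
  · exact fun h => ⟨fun x hx => mem_up_verts.1 (h.1 (mem_up_verts.2 hx)),
      fun x y hxy => up_adj.1 (h.2 (up_adj.2 hxy))⟩
  · exact fun h => SimpleGraph.Subgraph.map_mono h

theorem up_deleteEdges {x y : I} :
    (up F).deleteEdges {s(x.1, y.1)} = up (F.deleteEdges {s(x, y)}) := by
  have key : ∀ a b : I, s(a.1, b.1) = s(x.1, y.1) ↔ s(a, b) = s(x, y) := by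
    intro a b
    simp only [Sym2.eq_iff, Subtype.ext_iff]
  ext a b
  · rfl
  · constructor
    · intro h
      rw [SimpleGraph.Subgraph.deleteEdges_adj] at h
      obtain ⟨a, b, rfl, rfl⟩ := exists_of_up_adj h.1
      rw [up_adj, SimpleGraph.Subgraph.deleteEdges_adj]
      exact ⟨up_adj.1 h.1, fun h' => h.2 ((key a b).2 h')⟩
    · intro h
      obtain ⟨a, b, rfl, rfl⟩ := exists_of_up_adj h
      rw [up_adj, SimpleGraph.Subgraph.deleteEdges_adj] at h
      rw [SimpleGraph.Subgraph.deleteEdges_adj]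
      exact ⟨up_adj.2 h.1, fun h' => h.2 ((key a b).1 h')⟩

theorem bdry_up {x : I} (h : x ∈ bdry H) : x.1 ∈ bdry (up H) := by
  obtain ⟨h1, y, h2, h3⟩ := h
  exact ⟨mem_up_verts.2 h1, y, h2, fun h' => h3 (up_adj.1 h')⟩

/-- The restriction of a boundary condition to the boundary of `H` in the induced graph. -/
abbrev pullBd (φ : BdryCond (up H)) : BdryCond H :=
  Setoid.comap (fun x => ⟨x.1.1, bdry_up x.2⟩) φ

theorem bcRel_pullBd {φ : BdryCond (up H)} {x y : I} :
    bcRel (pullBd φ) x y ↔ x ∈ bdry H ∧ y ∈ bdry H ∧ bcRel φ x.1 y.1 :=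
  ⟨fun ⟨hx, hy, h⟩ => ⟨hx, hy, bdry_up hx, bdry_up hy, h⟩,
    fun ⟨hx, hy, _, _, h⟩ => ⟨hx, hy, h⟩⟩

/-- `φ` identifies only vertices of the boundary of `H` in the induced graph. -/
def Inner (φ : BdryCond (up H)) : Prop :=
  ∀ x y : I, x ≠ y → bcRel φ x.1 y.1 → x ∈ bdry H

theorem connMod_up {φ : BdryCond (up H)} (hφ : Inner φ) {x y : I} :
    ConnMod (up T) φ x.1 y.1 ↔ ConnMod T (pullBd φ) x y := by
  constructor
  · intro h
    suffices ∀ z : V, ConnMod (up T) φ x.1 z → x.1 = z ∨ ∃ z' : I, z'.1 = z ∧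
        ConnMod T (pullBd φ) x z' by
      rcases this y h with h' | ⟨z', h1, h2⟩
      · rw [Subtype.val_injective h']
        exact ConnMod.refl _
      · rwa [← Subtype.val_injective h1]
    intro z hz
    refine Or.inr (hz.induction (P := fun z => ∃ z' : I, z'.1 = z ∧ ConnMod T (pullBd φ) x z')
      ⟨x, rfl, ConnMod.refl _⟩ ?_)
    rintro _ b hab ⟨a, rfl, ha⟩
    have hb : b ∈ I := up_verts_subset hab.symm.mem_verts
    obtain ⟨b, rfl⟩ : ∃ b' : I, b'.1 = b := ⟨⟨b, hb⟩, rfl⟩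
    refine ⟨b, rfl, ha.trans ?_⟩
    rcases hab with hab | ⟨h1, h2, h3⟩
    · exact Step.connMod (Or.inl (up_adj.1 hab))
    · by_cases hne : a = b
      · rw [hne]
        exact ConnMod.refl _
      · exact Step.connMod (Or.inr ⟨mem_up_verts.1 h1, mem_up_verts.1 h2,
          bcRel_pullBd.2 ⟨hφ _ _ hne h3, hφ _ _ (Ne.symm hne) h3.symm, h3⟩⟩)
  · intro h
    refine h.le (R := fun x y : I => ConnMod (up T) φ x.1 y.1)
      ⟨fun _ => ConnMod.refl _, ConnMod.symm, ConnMod.trans⟩ fun a b hab => ?_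
    rcases hab with hab | ⟨h1, h2, h3⟩
    · exact Step.connMod (Or.inl (up_adj.2 hab))
    · exact Step.connMod (Or.inr ⟨mem_up_verts.2 h1, mem_up_verts.2 h2, (bcRel_pullBd.1 h3).2.2⟩)

theorem up_mem_forests_iff {φ : BdryCond (up H)} (hφ : Inner φ) :
    up F ∈ forests (up H) φ ↔ F ∈ forests H (pullBd φ) := by
  rw [mem_forests_iff, mem_forests_iff, up_le_iff, up_verts, up_verts,
    Subtype.val_injective.image_injective.eq_iff]
  refine and_congr_right fun _ => and_congr_right fun _ => ?_
  constructor
  · intro h x y hxy hc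
    refine h x.1 y.1 (up_adj.2 hxy) ?_
    rw [up_deleteEdges]
    exact (connMod_up hφ).2 hc
  · intro h a b hab hc
    obtain ⟨x, y, rfl, rfl⟩ := exists_of_up_adj hab
    rw [up_deleteEdges] at hc
    exact h x y (up_adj.1 hab) ((connMod_up hφ).1 hc)

theorem up_mem_maxForests_iff {φ : BdryCond (up H)} (hφ : Inner φ) :
    up F ∈ maxForests (up H) φ ↔ F ∈ maxForests H (pullBd φ) := by
  rw [mem_maxForests_iff, mem_maxForests_iff, up_mem_forests_iff hφ]
  refine and_congr_right fun _ => ?_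
  constructor
  · exact fun h x y hxy => (connMod_up hφ).1 (h x.1 y.1 (up_adj.2 hxy))
  · intro h a b hab
    obtain ⟨x, y, rfl, rfl⟩ := exists_of_up_adj hab
    exact (connMod_up hφ).2 (h x y (up_adj.1 hab))

theorem gibbsMass_up {φ : BdryCond (up H)} (hφ : Inner φ) :
    gibbsMass ∞ (up H) φ (up F) = gibbsMass ∞ H (pullBd φ) F := by
  have himage : maxForests (up H) φ = up '' maxForests H (pullBd φ) := by
    ext S
    constructor
    · intro hS
      have hS' : up (restrInd I S) = S :=
        up_restrInd ((mem_forests_iff.1 hS.1).1.1.trans up_verts_subset)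
      refine ⟨restrInd I S, ?_, hS'⟩
      rwa [← up_mem_maxForests_iff hφ, hS']
    · rintro ⟨S, hS, rfl⟩
      exact (up_mem_maxForests_iff hφ).2 hS
  rw [gibbsMass, gibbsMass, if_pos rfl, if_pos rfl]
  by_cases h : F ∈ maxForests H (pullBd φ)
  · rw [if_pos h, if_pos ((up_mem_maxForests_iff hφ).2 h), himage,
      Set.ncard_image_of_injective _ up_injective]
  · rw [if_neg h, if_neg fun h' => h ((up_mem_maxForests_iff hφ).1 h')]

/-- A finite subgraph of the induced graph, viewed as a finite subgraph of `G`. -/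
def upFin (H : FinSub (G.induce I)) : FinSub G := ⟨up H.1, H.2.image _⟩

theorem mem_augClass_of_augConn {o : V} {ω : AugSubgraph G} {x y : V} (hx : x ∈ augClass o ω)
    (h : AugConn ω x y) : y ∈ augClass o ω :=
  AugConn.trans (show AugConn ω o x from hx) h

theorem inner_bd (hlf : ∀ v, (G.neighborSet v).Finite) {o : V} {ω : AugSubgraph G}
    (hω : augClass o ω = I) (H : FinSub (G.induce I)) : Inner (H := H.1) (ω.bd (upFin H)) := by
  intro x y hne hxy
  refine ⟨mem_up_verts.1 hxy.1.1, ?_⟩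
  by_contra hcon
  push Not at hcon
  let star : G.Subgraph :=
    { verts := insert x.1 (G.neighborSet x.1)
      Adj := fun a b => G.Adj a b ∧ (a = x.1 ∨ b = x.1)
      adj_sub := fun h => h.1
      edge_vert := by
        rintro a b ⟨h, rfl | rfl⟩
        · exact Or.inl rfl
        · exact Or.inr h.symm
      symm := ⟨fun a b h => ⟨h.1.symm, h.2.symm⟩⟩ }
  let K : FinSub G := ⟨(upFin H).1 ⊔ star, (upFin H).2.union ((hlf x.1).insert _)⟩
  have hHK : (upFin H).1 ≤ K.1 := le_sup_left
  have hc := (bcRel_bd_iff hHK hxy.1 hxy.2.1).1 hxy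
  obtain ⟨z, hz | ⟨-, -, hz⟩⟩ := ConnMod.exists_step hc fun h => hne (Subtype.val_injective h)
  · rw [minusEdges_adj] at hz
    have hzI : z ∈ I := hω ▸ mem_augClass_of_augConn (hω.symm ▸ x.2) (augConn_of_adj hz.1.1)
    exact hz.2 (up_adj.2 (hcon ⟨z, hzI⟩ (ω.sub.adj_sub hz.1.1)))
  · obtain ⟨⟨-, w, hw, hw'⟩, -⟩ := hz
    exact hw' (Or.inr ⟨hw, Or.inl rfl⟩)

theorem up_minusEdges_restrInd {S : G.Subgraph} :
    up (minusEdges (restrInd I S ⊓ T) H) = minusEdges (S ⊓ up T) (up H) := by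
  ext a b
  · constructor
    · rintro ⟨x, hx, rfl⟩
      exact ⟨hx.1, mem_up_verts.2 hx.2⟩
    · rintro ⟨h, x, hx, rfl⟩
      exact ⟨x, ⟨h, hx⟩, rfl⟩
  · constructor
    · intro h
      obtain ⟨x, y, rfl, rfl⟩ := exists_of_up_adj h
      rw [up_adj, minusEdges_adj] at h
      rw [minusEdges_adj]
      exact ⟨⟨restrInd_adj.1 h.1.1, up_adj.2 h.1.2⟩, fun h' => h.2 (up_adj.1 h')⟩
    · intro h
      rw [minusEdges_adj] at h
      obtain ⟨x, y, rfl, rfl⟩ := exists_of_up_adj h.1.2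
      rw [up_adj, minusEdges_adj]
      exact ⟨⟨restrInd_adj.2 h.1.1, up_adj.1 h.1.2⟩, fun h' => h.2 (up_adj.2 h')⟩

/-- The augmented subgraph induced on the augmented connectivity class of `o`. -/
def restrAug (hlf : ∀ v, (G.neighborSet v).Finite) (o : V) (I : Set V)
    (ω : {ω : AugSubgraph G | augClass o ω = I}) : AugSubgraph (G.induce I) where
  sub := restrInd I ω.1.sub
  bd H := pullBd (ω.1.bd (upFin H))
  con H K hHK u v := by
    refine Iff.trans (ω.1.con (upFin H) (upFin K) (up_le_iff.2 hHK) ⟨u.1.1, bdry_up u.2⟩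
      ⟨v.1.1, bdry_up v.2⟩) ?_
    rw [← connMod_up (inner_bd hlf ω.2 K), up_minusEdges_restrInd]
    rfl

theorem restrInd_inf_eq_iff {S : G.Subgraph} :
    restrInd I S ⊓ H = F ↔ S ⊓ up H = up F := by
  have h : up (restrInd I S ⊓ H) = S ⊓ up H := by
    have := up_minusEdges_restrInd (I := I) (S := S) (T := H) (H := ⊥)
    rwa [minusEdges_bot, show up (⊥ : (G.induce I).Subgraph) = ⊥ from
      (SimpleGraph.Subgraph.eq_bot_iff_verts_eq_empty _).2 (Set.image_empty _), minusEdges_bot]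
      at this
  rw [← h, up_injective.eq_iff]

end Induce

theorem countable_of_connected (hconn : G.Connected) (hlf : ∀ v, (G.neighborSet v).Finite) :
    Countable V := by
  obtain ⟨o⟩ := hconn.nonempty
  let B : ℕ → Set V := fun n => n.rec {o} fun _ s => s ∪ ⋃ v ∈ s, G.neighborSet v
  have hB : ∀ n, (B n).Countable := by
    intro n
    induction n with
    | zero => exact Set.countable_singleton o
    | succ n ih => exact ih.union (ih.biUnion fun v _ => (hlf v).countable)
  have hcover : ∀ v, ∃ n, v ∈ B n := by
    intro v
    have h := hconn.preconnected o v
    rw [SimpleGraph.reachable_iff_reflTransGen] at h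
    induction h with
    | refl => exact ⟨0, rfl⟩
    | tail _ hbc ih =>
      obtain ⟨n, hn⟩ := ih
      exact ⟨n + 1, Or.inr (Set.mem_biUnion hn hbc)⟩
  refine Set.countable_univ_iff.1 ((Set.countable_iUnion hB).mono fun v _ => ?_)
  exact Set.mem_iUnion.2 (hcover v)

instance countable_finSub [Countable V] : Countable (FinSub G) := by
  classical
  have hE : ∀ H : FinSub G, {p : V × V | H.1.Adj p.1 p.2}.Finite := fun H =>
    (H.2.prod H.2).subset fun p hp => ⟨H.1.edge_vert hp, H.1.edge_vert hp.symm⟩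
  let f : FinSub G → Finset V × Finset (V × V) := fun H => (H.2.toFinset, (hE H).toFinset)
  refine Function.Injective.countable (f := f) fun H K h => ?_
  obtain ⟨h1, h2⟩ := Prod.ext_iff.1 h
  refine Subtype.ext (SimpleGraph.Subgraph.ext (Set.Finite.toFinset_inj.1 h1) ?_)
  ext x y
  exact Set.ext_iff.1 (Set.Finite.toFinset_inj.1 h2) (x, y)

instance finite_bdry (H : FinSub G) : Finite (bdry H.1) :=
  (H.2.subset fun _ h => h.1).to_subtype

instance finite_bdryCond (H : FinSub G) : Finite (BdryCond H.1) :=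
  Finite.of_injective (fun φ : BdryCond H.1 => fun u v => φ u v)
    fun _ _ h => Setoid.ext fun u v => iff_of_eq (congr_fun (congr_fun h u) v)

theorem measurableSet_rel {H : G.Subgraph} (u v : bdry H) :
    MeasurableSet {φ : BdryCond H | φ u v} :=
  MeasurableSpace.measurableSet_generateFrom ⟨u, v, rfl⟩

instance measurableSingletonClass_bdryCond (H : FinSub G) :
    MeasurableSingletonClass (BdryCond H.1) := by
  refine ⟨fun φ => ?_⟩
  have : ({φ} : Set (BdryCond H.1)) = ⋂ u, ⋂ v, {ψ | ψ u v ↔ φ u v} := by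
    ext ψ
    simp only [Set.mem_singleton_iff, Set.mem_iInter]
    exact ⟨fun h _ _ => by rw [h]; exact Iff.rfl, fun h => Setoid.ext h⟩
  rw [this]
  refine MeasurableSet.iInter fun u => MeasurableSet.iInter fun v => ?_
  by_cases h : φ u v
  · simpa only [h, iff_true] using measurableSet_rel u v
  · simp only [h, iff_false]
    exact (measurableSet_rel u v).compl

theorem measurableSet_vert (v : V) : MeasurableSet {S : G.Subgraph | v ∈ S.verts} :=
  MeasurableSpace.measurableSet_generateFrom (Or.inl ⟨v, rfl⟩)

theorem measurable_subgraph {Ω : Type*} {m : MeasurableSpace Ω} {f : Ω → G.Subgraph}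
    (hv : ∀ v, MeasurableSet {ω | v ∈ (f ω).verts})
    (he : ∀ u v, MeasurableSet {ω | (f ω).Adj u v}) : Measurable f := by
  refine measurable_generateFrom ?_
  rintro t (⟨v, rfl⟩ | ⟨u, v, rfl⟩)
  · exact hv v
  · exact he u v

instance measurableSingletonClass_subgraph [Countable V] : MeasurableSingletonClass G.Subgraph := by
  refine ⟨fun T => ?_⟩
  have : ({T} : Set G.Subgraph) = (⋂ v, {S | v ∈ S.verts ↔ v ∈ T.verts}) ∩
      ⋂ u, ⋂ v, {S | S.Adj u v ↔ T.Adj u v} := by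
    ext S
    simp only [Set.mem_singleton_iff, Set.mem_inter_iff, Set.mem_iInter]
    refine ⟨?_, fun h => SimpleGraph.Subgraph.ext (Set.ext h.1)
      (funext fun u => funext fun v => propext (h.2 u v))⟩
    rintro rfl
    exact ⟨fun _ => Iff.rfl, fun _ _ => Iff.rfl⟩
  rw [this]
  refine (MeasurableSet.iInter fun v => ?_).inter
    (MeasurableSet.iInter fun u => MeasurableSet.iInter fun v => ?_)
  · by_cases h : v ∈ T.verts
    · simpa only [h, iff_true] using measurableSet_vert v
    · simp only [h, iff_false]
      exact (measurableSet_vert v).compl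
  · by_cases h : T.Adj u v
    · simpa only [h, iff_true] using measurableSet_adj u v
    · simp only [h, iff_false]
      exact (measurableSet_adj u v).compl

instance countablyGenerated_subgraph [Countable V] :
    MeasurableSpace.CountablyGenerated G.Subgraph := by
  have h1 : {s | ∃ v : V, s = {S : G.Subgraph | v ∈ S.verts}}.Countable :=
    (Set.countable_range fun v : V => {S : G.Subgraph | v ∈ S.verts}).mono
      (by rintro _ ⟨v, rfl⟩; exact ⟨v, rfl⟩)
  have h2 : {s | ∃ u v : V, s = {S : G.Subgraph | S.Adj u v}}.Countable :=
    (Set.countable_range fun p : V × V => {S : G.Subgraph | S.Adj p.1 p.2}).mono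
      (by rintro _ ⟨u, v, rfl⟩; exact ⟨(u, v), rfl⟩)
  exact ⟨⟨_, h1.union h2, rfl⟩⟩

theorem countablyGenerated_iSup {α ι : Type*} [Countable ι] {m : ι → MeasurableSpace α}
    (h : ∀ i, @MeasurableSpace.CountablyGenerated α (m i)) :
    @MeasurableSpace.CountablyGenerated α (⨆ i, m i) := by
  choose b hb hm using fun i => (h i).isCountablyGenerated
  refine @MeasurableSpace.CountablyGenerated.mk _ (⨆ i, m i) ⟨⋃ i, b i, Set.countable_iUnion hb, ?_⟩
  rw [← MeasurableSpace.iSup_generateFrom]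
  exact iSup_congr hm

theorem countablyGenerated_outside [Countable V] (H : FinSub G) :
    @MeasurableSpace.CountablyGenerated _ (outside H) :=
  MeasurableSpace.CountablyGenerated.sup (.comap _) (countablyGenerated_iSup fun _ => .comap _)

theorem measurableSet_eqvGen {Ω : Type*} {m : MeasurableSpace Ω} [Countable V]
    {R : Ω → V → V → Prop} (h : ∀ a b, MeasurableSet {ω | R ω a b}) (x y : V) :
    MeasurableSet {ω | Relation.EqvGen (R ω) x y} := by
  let A : ℕ → V → Set Ω := fun n => n.rec (fun b => {_ω | x = b}) fun _ s b =>
    ⋃ c, s c ∩ ({ω | R ω c b} ∪ {ω | R ω b c})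
  have hA : ∀ n b, MeasurableSet (A n b) := by
    intro n
    induction n with
    | zero => exact fun b => MeasurableSet.const _
    | succ n ih =>
      exact fun b => MeasurableSet.iUnion fun c => (ih c).inter ((h c b).union (h b c))
  have : {ω | Relation.EqvGen (R ω) x y} = ⋃ n, A n y := by
    ext ω
    simp only [Set.mem_iUnion, Set.mem_ofPred_eq]
    constructor
    · rw [← Relation.EqvGen.reflTransGen_symmGen]
      intro hxy
      induction hxy with
      | refl => exact ⟨0, rfl⟩
      | tail _ hbc ih =>
        obtain ⟨n, hn⟩ := ih
        exact ⟨n + 1, Set.mem_iUnion.2 ⟨_, hn, hbc⟩⟩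
    · rintro ⟨n, hn⟩
      induction n generalizing y with
      | zero =>
        rw [show x = y from hn]
        exact .refl _
      | succ n ih =>
        obtain ⟨c, hc, hcy⟩ := Set.mem_iUnion.1 hn
        refine .trans _ _ _ (ih c hc) ?_
        rcases hcy with hcy | hcy
        · exact .rel _ _ hcy
        · exact .symm _ _ (.rel _ _ hcy)
  rw [this]
  exact MeasurableSet.iUnion fun n => hA n y

theorem measurableSet_bcRel {Ω : Type*} {m : MeasurableSpace Ω} {H : G.Subgraph}
    {f : Ω → BdryCond H} (hf : Measurable f) (a b : V) : MeasurableSet {ω | bcRel (f ω) a b} := by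
  by_cases ha : a ∈ bdry H
  · by_cases hb : b ∈ bdry H
    · convert! hf (measurableSet_rel ⟨a, ha⟩ ⟨b, hb⟩) using 1
      ext ω
      exact ⟨fun ⟨_, _, h⟩ => h, fun h => ⟨ha, hb, h⟩⟩
    · convert! MeasurableSet.empty using 1
      ext ω
      exact iff_of_false (fun h => hb h.2.1) id
  · convert! MeasurableSet.empty using 1
    ext ω
    exact iff_of_false (fun h => ha h.1) id

theorem measurableSet_connMod {Ω : Type*} {m : MeasurableSpace Ω} [Countable V] {H : G.Subgraph}
    {T : Ω → G.Subgraph} {φ : Ω → BdryCond H} (hT : Measurable T) (hφ : Measurable φ) (x y : V) :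
    MeasurableSet {ω | ConnMod (T ω) (φ ω) x y} :=
  measurableSet_eqvGen (fun a b => (hT (measurableSet_adj a b)).union
    ((hT (measurableSet_vert a)).inter ((hT (measurableSet_vert b)).inter
      (measurableSet_bcRel hφ a b)))) x y

theorem measurable_inf_right (K : G.Subgraph) : Measurable fun S : G.Subgraph => S ⊓ K :=
  measurable_subgraph (fun v => (measurableSet_vert v).inter (MeasurableSet.const (v ∈ K.verts)))
    fun u v => (measurableSet_adj u v).inter (MeasurableSet.const (K.Adj u v))

theorem measurable_sub : Measurable (AugSubgraph.sub : AugSubgraph G → G.Subgraph) :=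
  measurable_iff_comap_le.2 le_sup_left

theorem measurable_bd (H : FinSub G) : Measurable fun ω : AugSubgraph G => ω.bd H :=
  measurable_iff_comap_le.2 ((le_iSup (fun H : FinSub G => MeasurableSpace.comap
    (fun ω : AugSubgraph G => ω.bd H) inferInstance) H).trans le_sup_right)

theorem measurable_outside_minusEdges (H : FinSub G) :
    Measurable[outside H] fun ω : AugSubgraph G => minusEdges ω.sub H.1 := by
  rw [measurable_iff_comap_le]
  exact le_sup_left

theorem measurable_outside_bd {H K : FinSub G} (hHK : H.1 ≤ K.1) :
    Measurable[outside H] fun ω : AugSubgraph G => ω.bd K := by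
  rw [measurable_iff_comap_le]
  exact (le_iSup (fun K : {K : FinSub G // H.1 ≤ K.1} => MeasurableSpace.comap
    (fun ω : AugSubgraph G => ω.bd K.1) inferInstance) ⟨K, hHK⟩).trans le_sup_right

theorem measurableSet_outConn [Countable V] (H : FinSub G) (x y : V) :
    MeasurableSet[outside H] {ω : AugSubgraph G | OutConn ω H x y} := by
  have hT : ∀ ω : AugSubgraph G, minusEdges (ω.sub ⊓ (addPair H x y).1) H.1 =
      minusEdges ω.sub H.1 ⊓ (addPair H x y).1 := by
    intro ω
    ext a b
    · rfl
    · simp only [minusEdges_adj, SimpleGraph.Subgraph.inf_adj]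
      tauto
  simp only [OutConn, ConnIn, hT]
  exact measurableSet_connMod (m := outside H)
    ((measurable_inf_right _).comp (measurable_outside_minusEdges H))
    (measurable_outside_bd (le_addPair H x y)) x y

theorem measurable_outClass [Countable V] (o : V) (H : FinSub G) :
    Measurable[outside H] (outClass o H : AugSubgraph G → Set V) := by
  rw [@measurable_set_iff _ _ (outside H)]
  refine fun x => (@measurableSet_setOfPred _ (outside H) _).1 ?_
  have hx : {ω : AugSubgraph G | ∃ v ∈ H.1.verts, OutConn ω H v x} =
      ⋃ v ∈ H.1.verts, {ω | OutConn ω H v x} := by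
    ext ω
    simp
  refine (measurableSet_outConn H o x).union ?_
  change MeasurableSet[outside H] {ω : AugSubgraph G | ∃ v ∈ H.1.verts, OutConn ω H v x}
  rw [hx]
  exact MeasurableSet.biUnion (Set.to_countable _) fun v _ => measurableSet_outConn H v x

theorem measurableSet_reaches [Countable V] (o : V) (H : FinSub G) :
    MeasurableSet[outside H] {ω : AugSubgraph G | Reaches o H ω} := by
  by_cases hne : H.1.verts.Nonempty
  · have : {ω : AugSubgraph G | Reaches o H ω} =
        ⋃ v ∈ H.1.verts, {ω | OutConn ω H o v} := by
      ext ω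
      simp [Reaches, hne]
    exact this ▸ MeasurableSet.biUnion (Set.to_countable _) fun v _ => measurableSet_outConn H o v
  · have : {ω : AugSubgraph G | Reaches o H ω} = Set.univ := by
      ext ω
      simp [Reaches, hne]
    rw [this]
    exact @MeasurableSet.univ _ (outside H)

theorem measurable_augClass [Countable V] (o : V) :
    Measurable (augClass o : AugSubgraph G → Set V) := by
  refine measurable_set_iff.2 fun x => measurableSet_setOfPred.1 ?_
  exact (MeasurableSet.const (o = x)).union (measurableSet_bcRel (measurable_bd _) o x)

theorem measurable_restr {Ω : Type*} {m : MeasurableSpace Ω} {S : Ω → G.Subgraph} {I : Ω → Set V}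
    (hS : Measurable S) (hI : Measurable I) : Measurable fun ω => restr (S ω) (I ω) := by
  have hI' : ∀ v, MeasurableSet {ω | v ∈ I ω} := fun v =>
    measurableSet_setOfPred.2 (measurable_set_iff.1 hI v)
  refine measurable_subgraph (fun v => (hS (measurableSet_vert v)).inter (hI' v)) fun u v => ?_
  exact (hS (measurableSet_adj u v)).inter
    ((hI' u).inter ((hI' v).inter (MeasurableSet.const (G.Adj u v))))

theorem measurable_compl_set {Ω : Type*} {m : MeasurableSpace Ω} {I : Ω → Set V}
    (hI : Measurable I) : Measurable fun ω => (I ω)ᶜ :=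
  measurable_set_iff.2 fun v => (measurable_set_iff.1 hI v).not

theorem measurable_restrInd (I : Set V) : Measurable (restrInd I : G.Subgraph → _) :=
  measurable_subgraph (fun v => measurableSet_vert v.1) fun u v =>
    (MeasurableSet.const ((G.induce I).Adj u v)).inter (measurableSet_adj u.1 v.1)

/-! ### Augmented subgraphs form a standard Borel space -/

/-- The product space in which augmented subgraphs are encoded. -/
abbrev Code (G : SimpleGraph V) : Type _ :=
  ((V → Prop) × (V → V → Prop)) × ((H : FinSub G) → bdry H.1 → bdry H.1 → Prop)

/-- The coordinates of an augmented subgraph. -/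
def code (ω : AugSubgraph G) : Code G :=
  ((fun v => v ∈ ω.sub.verts, ω.sub.Adj), fun H u v => ω.bd H u v)

theorem code_injective : Function.Injective (code : AugSubgraph G → Code G) := by
  intro ω ω' h
  simp only [code, Prod.mk.injEq] at h
  obtain ⟨⟨h1, h2⟩, h3⟩ := h
  refine AugSubgraph.ext (SimpleGraph.Subgraph.ext (Set.ext fun v => iff_of_eq (congr_fun h1 v)) h2)
    (funext fun H => Setoid.ext fun u v => iff_of_eq ?_)
  exact congr_fun (congr_fun (congr_fun h3 H) u) v

theorem measurable_code : Measurable (code : AugSubgraph G → Code G) := by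
  refine Measurable.prodMk (Measurable.prodMk ?_ ?_) ?_
  · exact measurable_pi_lambda _ fun v => measurableSet_setOfPred.1
      (measurable_sub (measurableSet_vert v))
  · exact measurable_pi_lambda _ fun u => measurable_pi_lambda _ fun v => measurableSet_setOfPred.1
      (measurable_sub (measurableSet_adj u v))
  · exact measurable_pi_lambda _ fun H => measurable_pi_lambda _ fun u => measurable_pi_lambda _
      fun v => measurableSet_setOfPred.1 (measurable_bd H (measurableSet_rel u v))

theorem comap_code : MeasurableSpace.comap code inferInstance =
    (instMeasurableSpaceAugSubgraph : MeasurableSpace (AugSubgraph G)) := by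
  refine le_antisymm (measurable_iff_comap_le.1 measurable_code) (sup_le ?_ (iSup_le fun H => ?_))
  · refine (measurable_iff_comap_le (m₁ := MeasurableSpace.comap code inferInstance)).1 ?_
    refine measurable_subgraph (m := MeasurableSpace.comap code inferInstance) (fun v => ⟨{c | c.1.1 v}, ?_, rfl⟩)
      fun u v => ⟨{c | c.1.2 u v}, ?_, rfl⟩
    · exact measurableSet_setOfPred.2 ((measurable_pi_apply v).comp
        (measurable_fst.comp measurable_fst))
    · exact measurableSet_setOfPred.2 ((measurable_pi_apply v).comp ((measurable_pi_apply u).comp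
        (measurable_snd.comp measurable_fst)))
  · refine (measurable_iff_comap_le (m₁ := MeasurableSpace.comap code inferInstance)).1 ?_
    refine @measurable_generateFrom _ _ (MeasurableSpace.comap code inferInstance) _ _ ?_
    rintro _ ⟨u, v, rfl⟩
    refine ⟨{c | c.2 H u v}, ?_, rfl⟩
    exact measurableSet_setOfPred.2 ((measurable_pi_apply v).comp ((measurable_pi_apply u).comp
      ((measurable_pi_apply H).comp measurable_snd)))

/-- The steps of `((S ∩ K) ∖ E[H]) / Φ(K)`, in terms of coordinates. -/
def codeStep (c : Code G) (H K : FinSub G) (a b : V) : Prop :=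
  ((c.1.2 a b ∧ K.1.Adj a b) ∧ ¬ H.1.Adj a b) ∨
    ((c.1.1 a ∧ a ∈ K.1.verts) ∧ (c.1.1 b ∧ b ∈ K.1.verts) ∧
      ∃ (ha : a ∈ bdry K.1) (hb : b ∈ bdry K.1), c.2 K ⟨a, ha⟩ ⟨b, hb⟩)

/-- The coordinates come from an augmented subgraph. -/
structure IsCode (c : Code G) : Prop where
  adj_sub : ∀ u v, c.1.2 u v → G.Adj u v
  edge_vert : ∀ u v, c.1.2 u v → c.1.1 u
  symm : ∀ u v, c.1.2 u v → c.1.2 v u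
  bd_refl : ∀ H u, c.2 H u u
  bd_symm : ∀ H u v, c.2 H u v → c.2 H v u
  bd_trans : ∀ H u v w, c.2 H u v → c.2 H v w → c.2 H u w
  con : ∀ H K : FinSub G, H.1 ≤ K.1 → ∀ u v : bdry H.1,
    c.2 H u v ↔ Relation.EqvGen (codeStep c H K) u.1 v.1

theorem step_iff_codeStep {ω : AugSubgraph G} {H K : FinSub G} {a b : V} :
    Step (minusEdges (ω.sub ⊓ K.1) H.1) (ω.bd K) a b ↔ codeStep (code ω) H K a b :=
  or_congr minusEdges_adj Iff.rfl

theorem connMod_iff_codeStep {ω : AugSubgraph G} {H K : FinSub G} {a b : V} :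
    ConnMod (minusEdges (ω.sub ⊓ K.1) H.1) (ω.bd K) a b ↔
      Relation.EqvGen (codeStep (code ω) H K) a b := by
  have : codeStep (code ω) H K = Step (minusEdges (ω.sub ⊓ K.1) H.1) (ω.bd K) := by
    ext a b
    exact step_iff_codeStep.symm
  rw [this]
  exact Iff.rfl

theorem range_code : Set.range (code : AugSubgraph G → Code G) = {c | IsCode c} := by
  ext c
  constructor
  · rintro ⟨ω, rfl⟩
    exact
      { adj_sub := fun _ _ h => ω.sub.adj_sub h
        edge_vert := fun _ _ h => ω.sub.edge_vert h
        symm := fun _ _ h => SimpleGraph.Subgraph.Adj.symm h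
        bd_refl := fun H u => (ω.bd H).refl' u
        bd_symm := fun H u v h => (ω.bd H).symm' h
        bd_trans := fun H u v w h h' => (ω.bd H).trans' h h'
        con := fun H K hHK u v => (ω.con H K hHK u v).trans connMod_iff_codeStep }
  · intro hc
    let S : G.Subgraph :=
      { verts := {v | c.1.1 v}
        Adj := c.1.2
        adj_sub := fun h => hc.adj_sub _ _ h
        edge_vert := fun h => hc.edge_vert _ _ h
        symm := ⟨fun _ _ h => hc.symm _ _ h⟩ }
    let Φ : (H : FinSub G) → BdryCond H.1 := fun H =>
      ⟨c.2 H, hc.bd_refl H, fun h => hc.bd_symm H _ _ h, fun h h' => hc.bd_trans H _ _ _ h h'⟩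
    refine ⟨⟨S, Φ, fun H K hHK u v => (hc.con H K hHK u v).trans ?_⟩, rfl⟩
    have : codeStep c H K = Step (minusEdges (S ⊓ K.1) H.1) (Φ K) := by
      ext a b
      exact or_congr (minusEdges_adj (T := S ⊓ K.1) (H := H.1)).symm Iff.rfl
    rw [this]
    exact Iff.rfl

theorem measurableSet_isCode [Countable V] : MeasurableSet {c : Code G | IsCode c} := by
  have h1 : ∀ v, MeasurableSet {c : Code G | c.1.1 v} := fun v =>
    measurableSet_setOfPred.2 ((measurable_pi_apply v).comp (measurable_fst.comp measurable_fst))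
  have h2 : ∀ u v, MeasurableSet {c : Code G | c.1.2 u v} := fun u v =>
    measurableSet_setOfPred.2 ((measurable_pi_apply v).comp ((measurable_pi_apply u).comp
      (measurable_snd.comp measurable_fst)))
  have h3 : ∀ H u v, MeasurableSet {c : Code G | c.2 H u v} := fun H u v =>
    measurableSet_setOfPred.2 ((measurable_pi_apply v).comp ((measurable_pi_apply u).comp
      ((measurable_pi_apply H).comp measurable_snd)))
  have h4 : ∀ (H K : FinSub G) a b, MeasurableSet {c : Code G | codeStep c H K a b} := by
    intro H K a b
    refine (((h2 a b).inter (MeasurableSet.const _)).inter (MeasurableSet.const _)).union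
      (((h1 a).inter (MeasurableSet.const _)).inter
        (((h1 b).inter (MeasurableSet.const _)).inter ?_))
    exact measurableSet_setOfPred.2 (Measurable.exists fun ha => Measurable.exists fun hb =>
      measurableSet_setOfPred.1 (h3 K ⟨a, ha⟩ ⟨b, hb⟩))
  have h5 : ∀ (H K : FinSub G) a b,
      MeasurableSet {c : Code G | Relation.EqvGen (codeStep c H K) a b} := fun H K =>
    measurableSet_eqvGen (h4 H K)
  have : {c : Code G | IsCode c} =
      {c | (∀ u v, c.1.2 u v → G.Adj u v) ∧ (∀ u v, c.1.2 u v → c.1.1 u) ∧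
        (∀ u v, c.1.2 u v → c.1.2 v u) ∧ (∀ H u, c.2 H u u) ∧
        (∀ H u v, c.2 H u v → c.2 H v u) ∧ (∀ H u v w, c.2 H u v → c.2 H v w → c.2 H u w) ∧
        ∀ H K : FinSub G, H.1 ≤ K.1 → ∀ u v : bdry H.1,
          (c.2 H u v ↔ Relation.EqvGen (codeStep c H K) u.1 v.1)} := by
    ext c
    exact ⟨fun ⟨a1, a2, a3, a4, a5, a6, a7⟩ => ⟨a1, a2, a3, a4, a5, a6, a7⟩,
      fun ⟨a1, a2, a3, a4, a5, a6, a7⟩ => ⟨a1, a2, a3, a4, a5, a6, a7⟩⟩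
  rw [this, measurableSet_setOfPred]
  simp only [measurableSet_setOfPred] at h1 h2 h3 h5
  refine .and (.forall fun u => .forall fun v => .imp (h2 u v) measurable_const) <|
    .and (.forall fun u => .forall fun v => .imp (h2 u v) (h1 u)) <|
    .and (.forall fun u => .forall fun v => .imp (h2 u v) (h2 v u)) <|
    .and (.forall fun H => .forall fun u => h3 H u u) <|
    .and (.forall fun H => .forall fun u => .forall fun v => .imp (h3 H u v) (h3 H v u)) <|
    .and (.forall fun H => .forall fun u => .forall fun v => .forall fun w =>
      .imp (h3 H u v) (.imp (h3 H v w) (h3 H u w))) <|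
    .forall fun H => .forall fun K => .imp measurable_const <| .forall fun u => .forall fun v =>
      .iff (h3 H u v) (h5 H K u v)

theorem measurableEmbedding_code [Countable V] :
    MeasurableEmbedding (code : AugSubgraph G → Code G) := by
  refine ⟨code_injective, measurable_code, fun s hs => ?_⟩
  rw [← comap_code] at hs
  obtain ⟨t, ht, rfl⟩ := hs
  rw [Set.image_preimage_eq_inter_range, range_code]
  exact ht.inter measurableSet_isCode

theorem standardBorelSpace_of_measurableEmbedding {α β : Type*} [MeasurableSpace α]
    [MeasurableSpace β] [StandardBorelSpace β] {f : α → β} (hf : MeasurableEmbedding f) :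
    StandardBorelSpace α := by
  have := hf.measurableSet_range.standardBorel
  let e : α ≃ᵐ Set.range f := hf.equivRange
  let := upgradeStandardBorel (Set.range f)
  let : TopologicalSpace α := TopologicalSpace.induced e inferInstance
  refine ⟨‹_›, ⟨?_⟩, e.toEquiv.polishSpace_induced⟩
  rw [← hf.equivRange.measurableEmbedding.comap_eq, borel_comap]
  exact congrArg (MeasurableSpace.comap e) (eq_borel_upgradeStandardBorel (Set.range f))

instance standardBorelSpace_augSubgraph [Countable V] : StandardBorelSpace (AugSubgraph G) :=
  standardBorelSpace_of_measurableEmbedding measurableEmbedding_code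

theorem measurable_bdryCond_comp {Ω α : Type*} {m : MeasurableSpace Ω} [MeasurableSpace α]
    {H : FinSub G} {f : Ω → BdryCond H.1} (hf : Measurable f) (g : BdryCond H.1 → α) :
    Measurable fun ω => g (f ω) :=
  (measurable_of_countable g).comp hf

theorem measurable_outside_gibbsMass (β : ℝ≥0∞) (H : FinSub G) (F : G.Subgraph) :
    Measurable[outside H] fun ω : AugSubgraph G => gibbsMass β H.1 (ω.bd H) F :=
  measurable_bdryCond_comp (measurable_outside_bd le_rfl) fun φ => gibbsMass β H.1 φ F

theorem measurableSet_inf_eq [Countable V] (H : FinSub G) (F : G.Subgraph) :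
    MeasurableSet {ω : AugSubgraph G | ω.sub ⊓ H.1 = F} :=
  ((measurable_inf_right H.1).comp measurable_sub) (measurableSet_singleton F)

/-- The Gibbs property for `H` and `F`, in integrated form. -/
def GibbsAt (β : ℝ≥0∞) (Q : Measure (AugSubgraph G)) (H : FinSub G) (F : G.Subgraph) : Prop :=
  ∀ C, MeasurableSet[outside H] C → Q (C ∩ {ω | ω.sub ⊓ H.1 = F}) =
    ∫⁻ ω in C, ENNReal.ofReal (gibbsMass β H.1 (ω.bd H) F) ∂Q

theorem isAugGibbs_iff [Countable V] {β : ℝ≥0∞} {Q : Measure (AugSubgraph G)} :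
    IsAugGibbs G β Q ↔ IsProbabilityMeasure Q ∧ ∀ H F, GibbsAt β Q H F := by
  refine and_congr_right fun hQ => forall_congr' fun H => forall_congr' fun F => ?_
  have hS := measurableSet_inf_eq H F
  have hint : Integrable ({ω : AugSubgraph G | ω.sub ⊓ H.1 = F}.indicator fun _ => (1 : ℝ)) Q :=
    (integrable_const _).indicator hS
  have hm := (measurable_outside_gibbsMass β H F).mono (outside_le H) le_rfl
  have hset : ∀ C, MeasurableSet[outside H] C →
      ∫ ω in C, {ω : AugSubgraph G | ω.sub ⊓ H.1 = F}.indicator (fun _ => (1 : ℝ)) ω ∂Q =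
        Q.real (C ∩ {ω | ω.sub ⊓ H.1 = F}) := by
    intro C _
    rw [integral_indicator hS, setIntegral_const, smul_eq_mul, mul_one,
      measureReal_restrict_apply hS, Set.inter_comm]
  have hpos : ∀ C : Set (AugSubgraph G),
      0 ≤ᵐ[Q.restrict C] fun ω => gibbsMass β H.1 (ω.bd H) F := fun C =>
    Filter.Eventually.of_forall fun ω => gibbsMass_nonneg _ _ _ _
  constructor
  · intro h C hC
    have hgi : Integrable (fun ω : AugSubgraph G => gibbsMass β H.1 (ω.bd H) F) Q :=
      integrable_condExp.congr h
    rw [← ofReal_integral_eq_lintegral_ofReal hgi.integrableOn (hpos C),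
      ← setIntegral_congr_ae (outside_le H C hC) (h.mono fun ω hω _ => hω),
      setIntegral_condExp (outside_le H) hint hC, hset C hC, ofReal_measureReal]
  · intro h
    have hgi : Integrable (fun ω : AugSubgraph G => gibbsMass β H.1 (ω.bd H) F) Q := by
      refine ⟨hm.aestronglyMeasurable, ?_⟩
      rw [hasFiniteIntegral_iff_ofReal (Filter.Eventually.of_forall fun ω =>
        gibbsMass_nonneg _ _ _ _), ← setLIntegral_univ,
        ← h Set.univ (@MeasurableSet.univ _ (outside H))]
      exact measure_lt_top _ _
    refine (ae_eq_condExp_of_forall_setIntegral_eq (outside_le H) hint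
      (fun _ _ _ => hgi.integrableOn) (fun C hC _ => ?_)
      (measurable_outside_gibbsMass β H F).stronglyMeasurable.aestronglyMeasurable).symm
    rw [hset C hC, integral_eq_lintegral_of_nonneg_ae (hpos C) hm.aestronglyMeasurable,
      ← h C hC]
    rfl

theorem GibbsAt.lintegral [Countable V] {β : ℝ≥0∞} {Q : Measure (AugSubgraph G)}
    {H : FinSub G} {F : G.Subgraph} (h : GibbsAt β Q H F)
    {f : AugSubgraph G → ℝ≥0∞} (hf : Measurable[outside H] f) :
    ∫⁻ ω, {ω | ω.sub ⊓ H.1 = F}.indicator f ω ∂Q =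
      ∫⁻ ω, ENNReal.ofReal (gibbsMass β H.1 (ω.bd H) F) * f ω ∂Q := by
  have hS := measurableSet_inf_eq H F
  have hm : Measurable fun ω : AugSubgraph G => ENNReal.ofReal (gibbsMass β H.1 (ω.bd H) F) :=
    ((measurable_outside_gibbsMass β H F).mono (outside_le H) le_rfl).ennreal_ofReal
  have htrim : (Q.restrict {ω | ω.sub ⊓ H.1 = F}).trim (outside_le H) =
      (Q.withDensity fun ω => ENNReal.ofReal (gibbsMass β H.1 (ω.bd H) F)).trim (outside_le H) := by
    refine @Measure.ext _ (outside H) _ _ fun C hC => ?_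
    rw [trim_measurableSet_eq _ hC, trim_measurableSet_eq _ hC,
      Measure.restrict_apply (outside_le H C hC), withDensity_apply _ (outside_le H C hC)]
    exact h C hC
  rw [lintegral_indicator hS, ← lintegral_trim (outside_le H) hf, htrim,
    lintegral_trim (outside_le H) hf,
    lintegral_withDensity_eq_lintegral_mul _ hm (hf.mono (outside_le H) le_rfl)]
  rfl

/-- The augmented class of `o` together with the configuration outside of it. -/
def classData (o : V) (ω : AugSubgraph G) : Set V × G.Subgraph :=
  (augClass o ω, restr ω.sub (augClass o ω)ᶜ)

theorem measurable_classData [Countable V] (o : V) :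
    Measurable (classData o : AugSubgraph G → Set V × G.Subgraph) :=
  (measurable_augClass o).prodMk
    (measurable_restr measurable_sub (measurable_compl_set (measurable_augClass o)))

/-- On the event that the class of `o` contains `H`, the class data is a function of the outside
of `H`. -/
def outClassData (o : V) (H : FinSub G) (ω : AugSubgraph G) : Set V × G.Subgraph :=
  (outClass o H ω, restr (minusEdges ω.sub H.1) (outClass o H ω)ᶜ)

theorem measurable_outClassData [Countable V] (o : V) (H : FinSub G) :
    Measurable[outside H] (outClassData o H : AugSubgraph G → Set V × G.Subgraph) := by
  have h : Measurable[outside H] fun ω : AugSubgraph G =>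
      restr (minusEdges ω.sub H.1) (outClass o H ω)ᶜ :=
    measurable_restr (m := outside H) (measurable_outside_minusEdges H)
      (measurable_compl_set (m := outside H) (measurable_outClass o H))
  exact Measurable.prodMk (m := outside H) (f := outClass o H)
    (g := fun ω => restr (minusEdges ω.sub H.1) (outClass o H ω)ᶜ) (measurable_outClass o H) h

theorem classData_eq_outClassData {o : V} {H : FinSub G} {ω : AugSubgraph G}
    (h : H.1.verts ⊆ augClass o ω) : classData o ω = outClassData o H ω := by
  rw [classData, outClassData, restr_compl_eq h, augClass_eq_outClass h]

open Classical in
/-- The uniform Gibbs property holds for `H` on the event that `H` is contained in the class of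
`o`, even given the class data. -/
theorem measure_classData_inter [Countable V] {β : ℝ≥0∞} {Q : Measure (AugSubgraph G)}
    {o : V} {H : FinSub G} (hQ : ∀ F, GibbsAt β Q H F)
    (F : G.Subgraph) {D : Set (Set V × G.Subgraph)} (hD : MeasurableSet D)
    {C : Set (AugSubgraph G)} (hC : MeasurableSet[outside H] C) :
    Q (classData o ⁻¹' D ∩ {ω | H.1.verts ⊆ augClass o ω} ∩ C ∩ {ω | ω.sub ⊓ H.1 = F}) =
      ∫⁻ ω in classData o ⁻¹' D ∩ {ω | H.1.verts ⊆ augClass o ω} ∩ C,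
        ENNReal.ofReal (gibbsMass ∞ H.1 (ω.bd H) F) ∂Q := by
  set C' : Set (AugSubgraph G) := outClassData o H ⁻¹' D ∩ {ω | Reaches o H ω} ∩ C
  have hC' : MeasurableSet[outside H] C' :=
    ((measurable_outClassData o H hD).inter (measurableSet_reaches o H)).inter hC
  have hE : classData o ⁻¹' D ∩ {ω | H.1.verts ⊆ augClass o ω} ∩ C =
      C' ∩ {ω | ConnAll (ω.bd H) (ω.sub ⊓ H.1)} := by
    ext ω
    constructor
    · rintro ⟨⟨h1, h2⟩, h3⟩
      have h4 := subset_augClass_iff.1 h2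
      rw [Set.mem_preimage, classData_eq_outClassData h2] at h1
      exact ⟨⟨⟨h1, h4.1⟩, h3⟩, h4.2⟩
    · rintro ⟨⟨⟨h1, h2⟩, h3⟩, h4⟩
      have h5 := subset_augClass_iff.2 ⟨h2, h4⟩
      refine ⟨⟨?_, h5⟩, h3⟩
      rw [Set.mem_preimage, classData_eq_outClassData h5]
      exact h1
  have hB : ∀ T : G.Subgraph, MeasurableSet[outside H] (C' ∩ {ω | ConnAll (ω.bd H) T}) := fun T =>
    hC'.inter ((measurable_outside_bd le_rfl) (Set.toFinite {φ | ConnAll φ T}).measurableSet)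
  have hg : ∀ (γ : ℝ≥0∞) (T : G.Subgraph), Measurable[outside H] fun ω : AugSubgraph G =>
      ENNReal.ofReal (gibbsMass γ H.1 (ω.bd H) T) := fun γ T =>
    (measurable_outside_gibbsMass γ H T).ennreal_ofReal
  have hEm : MeasurableSet (C' ∩ {ω | ConnAll (ω.bd H) (ω.sub ⊓ H.1)}) := by
    rw [← hE]
    refine ((measurable_classData o hD).inter ?_).inter (outside_le H C hC)
    have : {ω : AugSubgraph G | H.1.verts ⊆ augClass o ω} =
        ⋂ v ∈ H.1.verts, {ω | v ∈ augClass o ω} := by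
      ext ω
      simp [Set.subset_def]
    rw [this]
    exact MeasurableSet.biInter (Set.to_countable _) fun v _ =>
      measurableSet_setOfPred.2 (measurable_set_iff.1 (measurable_augClass o) v)
  set s := (finite_setOf_le H.2).toFinset
  have hleft : (C' ∩ {ω | ConnAll (ω.bd H) (ω.sub ⊓ H.1)} ∩ {ω | ω.sub ⊓ H.1 = F}).indicator 1 =
      {ω : AugSubgraph G | ω.sub ⊓ H.1 = F}.indicator
        ((C' ∩ {ω | ConnAll (ω.bd H) F}).indicator (1 : AugSubgraph G → ℝ≥0∞)) := by
    rw [Set.indicator_indicator]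
    congr 1
    ext ω
    constructor
    · rintro ⟨⟨h1, h2⟩, h3⟩
      replace h3 : ω.sub ⊓ H.1 = F := h3
      refine ⟨h3, h1, ?_⟩
      change ConnAll (ω.bd H) F
      rw [← h3]
      exact h2
    · rintro ⟨h3, h1, h2⟩
      replace h3 : ω.sub ⊓ H.1 = F := h3
      refine ⟨⟨h1, ?_⟩, h3⟩
      change ConnAll (ω.bd H) (ω.sub ⊓ H.1)
      rw [h3]
      exact h2
  have hright : (C' ∩ {ω | ConnAll (ω.bd H) (ω.sub ⊓ H.1)}).indicator
      (fun ω => ENNReal.ofReal (gibbsMass ∞ H.1 (ω.bd H) F)) =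
      fun ω => ∑ T ∈ s, {ω : AugSubgraph G | ω.sub ⊓ H.1 = T}.indicator
        ((C' ∩ {ω | ConnAll (ω.bd H) T}).indicator
          fun ω => ENNReal.ofReal (gibbsMass ∞ H.1 (ω.bd H) F)) ω := by
    ext ω
    rw [Finset.sum_eq_single (ω.sub ⊓ H.1)]
    · rw [Set.indicator_of_mem (s := {ω' : AugSubgraph G | ω'.sub ⊓ H.1 = ω.sub ⊓ H.1})
        (show ω.sub ⊓ H.1 = ω.sub ⊓ H.1 from rfl)]
      rfl
    · intro T _ hT
      exact Set.indicator_of_notMem (s := {ω' : AugSubgraph G | ω'.sub ⊓ H.1 = T})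
        (fun h : ω.sub ⊓ H.1 = T => hT h.symm) _
    · intro h
      exact (h ((finite_setOf_le H.2).mem_toFinset.2 (show _ ≤ H.1 from inf_le_right))).elim
  have hmeas : ∀ T : G.Subgraph, Measurable[outside H] ((C' ∩ {ω | ConnAll (ω.bd H) T}).indicator
      fun ω => ENNReal.ofReal (gibbsMass ∞ H.1 (ω.bd H) F)) := fun T => (hg ∞ F).indicator (hB T)
  have hone : Measurable[outside H]
      ((C' ∩ {ω | ConnAll (ω.bd H) F}).indicator (1 : AugSubgraph G → ℝ≥0∞)) :=
    (@measurable_const _ _ _ (outside H) 1).indicator (hB F)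
  have hsum := lintegral_finsetSum (μ := Q) s fun T _ =>
    ((hg β T).mono (outside_le H) le_rfl).mul ((hmeas T).mono (outside_le H) le_rfl)
  rw [hE, ← lintegral_indicator_one (hEm.inter (measurableSet_inf_eq H F)), hleft,
    (hQ F).lintegral hone, ← lintegral_indicator hEm, hright,
    lintegral_finsetSum _ fun T _ => ((hmeas T).mono (outside_le H) le_rfl).indicator
      (measurableSet_inf_eq H T),
    Finset.sum_congr rfl fun T _ => (hQ T).lintegral (hmeas T)]
  refine Eq.trans ?_ hsum
  refine lintegral_congr fun ω => ?_
  by_cases hω : ω ∈ C'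
  · have key := gibbsMass_connAll β H.2 (ω.bd H) F
    have h1 : ∀ (T : G.Subgraph) (f : AugSubgraph G → ℝ≥0∞),
        (C' ∩ {ω | ConnAll (ω.bd H) T}).indicator f ω = if ConnAll (ω.bd H) T then f ω else 0 := by
      intro T f
      rw [Set.indicator_apply]
      simp [hω]
    simp only [Pi.mul_apply, h1]
    have hnn : ∀ T : G.Subgraph, 0 ≤ if ConnAll (ω.bd H) T then gibbsMass β H.1 (ω.bd H) T else 0 := by
      intro T
      split_ifs
      · exact gibbsMass_nonneg _ _ _ _
      · exact le_rfl
    have hl : ENNReal.ofReal (gibbsMass β H.1 (ω.bd H) F) *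
        (if ConnAll (ω.bd H) F then (1 : AugSubgraph G → ℝ≥0∞) ω else 0) =
        ENNReal.ofReal (if ConnAll (ω.bd H) F then gibbsMass β H.1 (ω.bd H) F else 0) := by
      split_ifs <;> simp
    rw [hl, key, ENNReal.ofReal_mul (gibbsMass_nonneg _ _ _ _),
      ENNReal.ofReal_sum_of_nonneg fun T _ => hnn T, Finset.mul_sum]
    refine Finset.sum_congr rfl fun T _ => ?_
    split_ifs
    · rw [mul_comm]
    · simp
  · have h1 : ∀ T : G.Subgraph, ω ∉ C' ∩ {ω | ConnAll (ω.bd H) T} := fun T h => hω h.1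
    simp [Set.indicator_of_notMem (h1 _)]

/-! ### Conditioning on the class of `o` -/

theorem gibbsMass_top_eq_zero {H F : G.Subgraph} (h : ¬ F ≤ H) (φ : BdryCond H) :
    gibbsMass ∞ H φ F = 0 := by
  by_contra h0
  exact h (mem_forests_iff.1 (mem_forests_of_gibbsMass_ne_zero h0)).1

theorem gibbsAt_of_not_le {μ : Measure (AugSubgraph G)} {H : FinSub G} {F : G.Subgraph}
    (h : ¬ F ≤ H.1) : GibbsAt ∞ μ H F := by
  intro C _
  have : {ω : AugSubgraph G | ω.sub ⊓ H.1 = F} = ∅ :=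
    Set.eq_empty_of_forall_notMem fun ω (hω : ω.sub ⊓ H.1 = F) => h (hω ▸ inf_le_right)
  rw [this, Set.inter_empty, measure_empty]
  simp [gibbsMass_top_eq_zero h]

theorem setLIntegral_map_kernel [Countable V] {Q : Measure (AugSubgraph G)}
    [IsProbabilityMeasure Q] {Y : AugSubgraph G → Set V × G.Subgraph} (hY : Measurable Y)
    {K : Kernel (Set V × G.Subgraph) (AugSubgraph G)} [IsMarkovKernel K]
    (hK : Q.map Y ⊗ₘ K = Q.map fun ω => (Y ω, ω)) {h : AugSubgraph G → ℝ≥0∞} (hh : Measurable h)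
    {D : Set (Set V × G.Subgraph)} (hD : MeasurableSet D) :
    ∫⁻ y in D, ∫⁻ ω, h ω ∂(K y) ∂(Q.map Y) = ∫⁻ ω in Y ⁻¹' D, h ω ∂Q := by
  have hm : Measurable fun p : (Set V × G.Subgraph) × AugSubgraph G => h p.2 :=
    hh.comp measurable_snd
  have := Measure.setLIntegral_compProd (μ := Q.map Y) (κ := K) hm hD MeasurableSet.univ
  simp only [Measure.restrict_univ] at this
  have hYid : Measurable fun ω => (Y ω, ω) := hY.prodMk measurable_id
  rw [← this, hK, setLIntegral_map (hD.prod MeasurableSet.univ) hm hYid]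
  congr 2
  ext ω
  simp

theorem exists_countable_isSetAlgebra [Countable V] (H : FinSub G) :
    ∃ 𝒜 : Set (Set (AugSubgraph G)), 𝒜.Countable ∧ IsSetAlgebra 𝒜 ∧
      outside H = MeasurableSpace.generateFrom 𝒜 := by
  obtain ⟨b, hb, hgen⟩ := (countablyGenerated_outside H).isCountablyGenerated
  exact ⟨generateSetAlgebra b, countable_generateSetAlgebra hb, isSetAlgebra_generateSetAlgebra,
    by rw [generateFrom_generateSetAlgebra_eq, hgen]⟩

theorem ae_gibbsAt [Countable V] {β : ℝ≥0∞} {Q : Measure (AugSubgraph G)}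
    (hQ : IsAugGibbs G β Q) (o : V) {K : Kernel (Set V × G.Subgraph) (AugSubgraph G)}
    [IsMarkovKernel K] (hK : Q.map (classData o) ⊗ₘ K = Q.map fun ω => (classData o ω, ω)) :
    ∀ᵐ y ∂(Q.map (classData o)), ∀ (H : FinSub G) (F : G.Subgraph), H.1.verts ⊆ y.1 →
      GibbsAt ∞ (K y) H F := by
  have hQ' := isAugGibbs_iff.1 hQ
  have := hQ'.1
  have hY := measurable_classData (G := G) o
  have hP : ∀ H : FinSub G, MeasurableSet {y : Set V × G.Subgraph | H.1.verts ⊆ y.1} := by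
    intro H
    have : {y : Set V × G.Subgraph | H.1.verts ⊆ y.1} = ⋂ v ∈ H.1.verts, {y | v ∈ y.1} := by
      ext y
      simp [Set.subset_def]
    rw [this]
    exact MeasurableSet.biInter (Set.to_countable _) fun v _ =>
      measurableSet_setOfPred.2 (measurable_set_iff.1 measurable_fst v)
  have hg : ∀ (H : FinSub G) (F : G.Subgraph), Measurable fun ω : AugSubgraph G =>
      ENNReal.ofReal (gibbsMass ∞ H.1 (ω.bd H) F) := fun H F =>
    ((measurable_outside_gibbsMass ∞ H F).mono (outside_le H) le_rfl).ennreal_ofReal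
  have hone : ∀ (H : FinSub G) (F : G.Subgraph) (C : Set (AugSubgraph G)),
      MeasurableSet[outside H] C → ∀ᵐ y ∂(Q.map (classData o)), H.1.verts ⊆ y.1 →
        K y (C ∩ {ω | ω.sub ⊓ H.1 = F}) =
          ∫⁻ ω in C, ENNReal.ofReal (gibbsMass ∞ H.1 (ω.bd H) F) ∂(K y) := by
    intro H F C hC
    have hCS := (outside_le H C hC).inter (measurableSet_inf_eq H F)
    have hgC := (hg H F).indicator (outside_le H C hC)
    refine (ae_restrict_iff' (hP H)).1 (ae_eq_of_forall_setLIntegral_eq_of_sigmaFinite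
      (K.measurable_coe hCS) ?_ fun D hD _ => ?_)
    · simp_rw [← lintegral_indicator (outside_le H C hC)]
      exact hgC.lintegral_kernel
    · rw [Measure.restrict_restrict hD]
      simp_rw [← lintegral_indicator (outside_le H C hC), ← lintegral_indicator_one hCS]
      rw [setLIntegral_map_kernel hY hK (measurable_one.indicator hCS) (hD.inter (hP H)),
        setLIntegral_map_kernel hY hK hgC (hD.inter (hP H)),
        lintegral_indicator_one hCS, Measure.restrict_apply hCS,
        setLIntegral_indicator (outside_le H C hC)]
      have := measure_classData_inter (o := o) (hQ'.2 H) F hD hC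
      rw [Set.inter_comm C (_ ⁻¹' _), Set.inter_comm (C ∩ _), ← Set.inter_assoc]
      exact this
  choose 𝒜 hcount halg hgen using exists_countable_isSetAlgebra (G := G)
  have hmem : ∀ (H : FinSub G), ∀ C ∈ 𝒜 H, MeasurableSet[outside H] C := fun H C hC => by
    rw [hgen H]
    exact MeasurableSpace.measurableSet_generateFrom hC
  have hall : ∀ᵐ y ∂(Q.map (classData o)), ∀ (H F : FinSub G),
      ∀ C ∈ 𝒜 H, H.1.verts ⊆ y.1 →
        K y (C ∩ {ω | ω.sub ⊓ H.1 = F.1}) =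
          ∫⁻ ω in C, ENNReal.ofReal (gibbsMass ∞ H.1 (ω.bd H) F.1) ∂(K y) := by
    refine ae_all_iff.2 fun H => ae_all_iff.2 fun F => ?_
    exact (ae_ball_iff (hcount H)).2 fun C hC => hone H F.1 C (hmem H C hC)
  filter_upwards [hall] with y hy H F hHy
  by_cases hF : F ≤ H.1
  swap
  · exact gibbsAt_of_not_le hF
  intro C hC
  have hCm := outside_le H C hC
  have hS := measurableSet_inf_eq H F
  have hy' := hy H ⟨F, H.2.subset hF.1⟩
  have heq : ∀ C ∈ 𝒜 H, (K y).restrict {ω | ω.sub ⊓ H.1 = F} C =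
      (K y).withDensity (fun ω => ENNReal.ofReal (gibbsMass ∞ H.1 (ω.bd H) F)) C := by
    intro C hC
    rw [Measure.restrict_apply' hS, withDensity_apply _ (outside_le H C (hmem H C hC))]
    exact hy' C hC hHy
  have := ext_on_measurableSpace_of_generate_finite _ (𝒜 H) heq (outside_le H) (hgen H)
    (fun s hs t ht _ => (halg H).inter_mem hs ht) (heq _ (halg H).univ_mem) hC
  rwa [Measure.restrict_apply' hS, withDensity_apply _ hCm] at this

/-! ### Gibbs measures on the induced graph -/

theorem comap_outside_le {Ω : Type*} {m : MeasurableSpace Ω} {f : Ω → AugSubgraph G}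
    {H : FinSub G} (h1 : Measurable fun ω => minusEdges (f ω).sub H.1)
    (h2 : ∀ K : FinSub G, H.1 ≤ K.1 → Measurable fun ω => (f ω).bd K) :
    (outside H).comap f ≤ m := by
  rw [outside, MeasurableSpace.comap_sup, MeasurableSpace.comap_iSup,
    MeasurableSpace.comap_comp]
  refine sup_le (measurable_iff_comap_le.1 h1) (iSup_le fun K => ?_)
  rw [MeasurableSpace.comap_comp]
  exact measurable_iff_comap_le.1 (h2 K.1 K.2)

theorem measurable_augSubgraph {Ω : Type*} {m : MeasurableSpace Ω} {f : Ω → AugSubgraph G}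
    (h1 : Measurable fun ω => (f ω).sub) (h2 : ∀ K : FinSub G, Measurable fun ω => (f ω).bd K) :
    Measurable f := by
  rw [measurable_iff_comap_le, instMeasurableSpaceAugSubgraph, MeasurableSpace.comap_sup,
    MeasurableSpace.comap_iSup, MeasurableSpace.comap_comp]
  refine sup_le (measurable_iff_comap_le.1 h1) (iSup_le fun K => ?_)
  rw [MeasurableSpace.comap_comp]
  exact measurable_iff_comap_le.1 (h2 K)

section Induce

variable {I : Set V}

theorem measurable_pullBd (H : (G.induce I).Subgraph) : Measurable (pullBd (H := H)) := by
  refine measurable_generateFrom ?_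
  rintro _ ⟨u, v, rfl⟩
  exact measurableSet_rel (⟨u.1.1, bdry_up u.2⟩ : bdry (up H)) ⟨v.1.1, bdry_up v.2⟩

theorem minusEdges_restrInd {S : G.Subgraph} {H : (G.induce I).Subgraph} :
    minusEdges (restrInd I S) H = restrInd I (minusEdges S (up H)) := by
  ext x y
  · rfl
  · rw [minusEdges_adj, restrInd_adj, restrInd_adj, minusEdges_adj, up_adj]

variable (hlf : ∀ v, (G.neighborSet v).Finite) (o : V)

theorem measurable_restrAug : Measurable (restrAug hlf o I) :=
  measurable_augSubgraph
    ((measurable_restrInd I).comp (measurable_sub.comp measurable_subtype_coe))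
    fun K => (measurable_pullBd K.1).comp ((measurable_bd (upFin K)).comp measurable_subtype_coe)

theorem comap_restrAug_outside_le (H : FinSub (G.induce I)) :
    (outside H).comap (restrAug hlf o I) ≤ (outside (upFin H)).comap Subtype.val := by
  have hval : @Measurable _ _ ((outside (upFin H)).comap Subtype.val) (outside (upFin H))
      (Subtype.val : {ω : AugSubgraph G | augClass o ω = I} → AugSubgraph G) :=
    measurable_iff_comap_le.2 le_rfl
  refine comap_outside_le (m := (outside (upFin H)).comap Subtype.val) ?_ fun K hK => ?_
  · have : (fun ω => minusEdges (restrAug hlf o I ω).sub H.1) =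
        (restrInd I ∘ fun ω : AugSubgraph G => minusEdges ω.sub (upFin H).1) ∘ Subtype.val :=
      funext fun _ => minusEdges_restrInd
    rw [this]
    exact ((measurable_restrInd I).comp (measurable_outside_minusEdges (upFin H))).comp hval
  · exact (measurable_pullBd K.1).comp
      ((measurable_outside_bd (up_le_iff.2 hK : (upFin H).1 ≤ (upFin K).1)).comp hval)

variable {o}

theorem measurableSet_augClass_eq [Countable V] (I : Set V) :
    MeasurableSet {ω : AugSubgraph G | augClass o ω = I} := by
  have : {ω : AugSubgraph G | augClass o ω = I} = ⋂ v, {ω | v ∈ augClass o ω ↔ v ∈ I} := by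
    ext ω
    simp [Set.ext_iff]
  rw [this]
  exact MeasurableSet.iInter fun v => measurableSet_setOfPred.2
    ((measurable_set_iff.1 (measurable_augClass o) v).iff measurable_const)

/-- The law of the augmented subgraph induced on the class of `o`, if this class is `I`. -/
noncomputable def restrLaw (o : V) (I : Set V) (μ : Measure (AugSubgraph G)) :
    Measure (AugSubgraph (G.induce I)) :=
  (μ.comap Subtype.val).map (restrAug hlf o I)

theorem lintegral_comap_val [Countable V] {μ : Measure (AugSubgraph G)}
    (hI : ∀ᵐ ω ∂μ, augClass o ω = I) (f : AugSubgraph G → ℝ≥0∞) :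
    ∫⁻ ω : {ω : AugSubgraph G | augClass o ω = I}, f ω ∂(μ.comap Subtype.val) = ∫⁻ ω, f ω ∂μ := by
  have hm := measurableSet_augClass_eq (G := G) (o := o) I
  rw [lintegral_subtype_comap hm, Measure.restrict_eq_self_of_ae_mem
    (s := {ω : AugSubgraph G | augClass o ω = I}) hI]

theorem isAugGibbs_restrLaw [Countable V] {μ : Measure (AugSubgraph G)} [IsProbabilityMeasure μ]
    (hI : ∀ᵐ ω ∂μ, augClass o ω = I)
    (h : ∀ (H : FinSub G) (F : G.Subgraph), H.1.verts ⊆ I → GibbsAt ∞ μ H F) :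
    IsAugGibbs (G.induce I) ∞ (restrLaw hlf o I μ) := by
  have hT := measurable_restrAug hlf o (I := I)
  rw [isAugGibbs_iff]
  constructor
  · constructor
    rw [restrLaw, Measure.map_apply hT MeasurableSet.univ, Set.preimage_univ, ← lintegral_one,
      lintegral_comap_val hI fun _ => 1, lintegral_one, measure_univ]
  · intro H F B hB
    obtain ⟨C, hC, hBC⟩ : ∃ C, MeasurableSet[outside (upFin H)] C ∧
        Subtype.val ⁻¹' C = restrAug hlf o I ⁻¹' B :=
      comap_restrAug_outside_le hlf o H _ ⟨B, hB, rfl⟩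
    have hCm := outside_le _ C hC
    have hBm := outside_le _ B hB
    have hS := measurableSet_inf_eq H F
    have hS' := measurableSet_inf_eq (upFin H) (up F)
    have hset : restrAug hlf o I ⁻¹' (B ∩ {ω | ω.sub ⊓ H.1 = F}) =
        Subtype.val ⁻¹' (C ∩ {ω | ω.sub ⊓ (upFin H).1 = up F}) := by
      rw [Set.preimage_inter, Set.preimage_inter, hBC]
      congr 1
      ext ω
      exact restrInd_inf_eq_iff
    have hg : Measurable fun ω : AugSubgraph (G.induce I) =>
        ENNReal.ofReal (gibbsMass ∞ H.1 (ω.bd H) F) :=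
      ((measurable_outside_gibbsMass ∞ H F).mono (outside_le H) le_rfl).ennreal_ofReal
    rw [restrLaw, Measure.map_apply hT (hBm.inter hS), hset, setLIntegral_map hBm hg hT, ← hBC]
    have h1 : (μ.comap Subtype.val) (Subtype.val ⁻¹' (C ∩ {ω | ω.sub ⊓ (upFin H).1 = up F}) :
        Set {ω : AugSubgraph G | augClass o ω = I}) =
          μ (C ∩ {ω | ω.sub ⊓ (upFin H).1 = up F}) := by
      rw [← lintegral_indicator_one (measurable_subtype_coe (hCm.inter hS')),
        ← lintegral_indicator_one (hCm.inter hS'), ← lintegral_comap_val hI]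
      rfl
    rw [h1, h (upFin H) (up F) up_verts_subset C hC, ← lintegral_indicator hCm,
      ← lintegral_comap_val hI, ← lintegral_indicator (measurable_subtype_coe hCm)]
    refine lintegral_congr fun ω => ?_
    by_cases hω : ω.1 ∈ C
    · rw [Set.indicator_of_mem hω, Set.indicator_of_mem (show ω ∈ Subtype.val ⁻¹' C from hω)]
      exact congrArg ENNReal.ofReal (gibbsMass_up (inner_bd hlf ω.2 H))
    · rw [Set.indicator_of_notMem hω,
        Set.indicator_of_notMem (show ω ∉ Subtype.val ⁻¹' C from hω)]

theorem map_sub_restrLaw [Countable V] {μ : Measure (AugSubgraph G)}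
    (hI : ∀ᵐ ω ∂μ, augClass o ω = I) :
    (restrLaw hlf o I μ).map AugSubgraph.sub =
      (μ.map fun ω => restr ω.sub (augClass o ω)).map (restrInd I) := by
  have hm := measurableSet_augClass_eq (G := G) (o := o) I
  have h1 : AugSubgraph.sub ∘ restrAug hlf o I =
      (restrInd I ∘ AugSubgraph.sub) ∘ Subtype.val := rfl
  rw [restrLaw, Measure.map_map measurable_sub (measurable_restrAug hlf o), h1,
    ← Measure.map_map ((measurable_restrInd I).comp measurable_sub) measurable_subtype_coe,
    map_comap_subtype_coe hm, Measure.restrict_eq_self_of_ae_mem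
    (s := {ω : AugSubgraph G | augClass o ω = I}) hI,
    Measure.map_map (measurable_restrInd I) (measurable_restr measurable_sub
      (measurable_augClass o))]
  refine Measure.map_congr (hI.mono fun ω hω => ?_)
  simp only [Function.comp_apply]
  rw [hω]
  ext x y
  · exact ⟨fun h => ⟨h, x.2⟩, fun h => h.1⟩
  · rw [restrInd_adj, restrInd_adj]
    exact ⟨fun h => ⟨h, x.2, y.2, ω.sub.adj_sub h⟩, fun h => h.1⟩

end Induce

theorem isSpanningForest_top {S : G.Subgraph}
    (h : ∀ H : FinSub G, ∃ φ, S ⊓ H.1 ∈ forests H.1 φ) : IsSpanningForest ⊤ S := by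
  refine ⟨le_top, Set.eq_univ_of_forall fun v => ?_, isAcyclic_coe_of_spanningCoe ?_⟩
  · obtain ⟨φ, hφ⟩ := h (pairSub G v v)
    have hv : v ∈ (S ⊓ (pairSub G v v).1).verts := (mem_forests_iff.1 hφ).2.1 ▸ Or.inl rfl
    exact hv.1
  · intro v p hp
    obtain ⟨φ, hφ⟩ := h ⟨(⊤ : G.Subgraph).induce {w | w ∈ p.support}, p.support.finite_toSet⟩
    have hE : ∀ e ∈ p.edges, e ∈ (S ⊓ (⊤ : G.Subgraph).induce
        {w | w ∈ p.support}).spanningCoe.edgeSet := by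
      intro e
      induction e using Sym2.ind with | _ a b => ?_
      intro he
      have hab : S.Adj a b := p.edges_subset_edgeSet he
      exact ⟨hab, p.fst_mem_support_of_mem_edges he, p.snd_mem_support_of_mem_edges he,
        S.adj_sub hab⟩
    exact (mem_forests_iff.1 hφ).2.2.isAcyclic_spanningCoe (p.transfer _ hE) (hp.transfer hE)

theorem IsAugGibbs.ae_isSpanningForest [Countable V] {β : ℝ≥0∞} {Q : Measure (AugSubgraph G)}
    (hQ : IsAugGibbs G β Q) : ∀ᵐ S ∂(Q.map AugSubgraph.sub), IsSpanningForest ⊤ S := by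
  have hQ' := isAugGibbs_iff.1 hQ
  have h : ∀ᵐ S ∂(Q.map AugSubgraph.sub), ∀ H F : FinSub G, S ⊓ H.1 = F.1 →
      ∃ φ, F.1 ∈ forests H.1 φ := by
    refine ae_all_iff.2 fun H => ae_all_iff.2 fun F => ?_
    by_cases hF : ∃ φ, F.1 ∈ forests H.1 φ
    · exact Filter.Eventually.of_forall fun _ _ => hF
    · have h0 := hQ'.2 H F.1 Set.univ (@MeasurableSet.univ _ (outside H))
      have hz : ∀ ω : AugSubgraph G, gibbsMass β H.1 (ω.bd H) F.1 = 0 := fun ω => by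
        by_contra h
        exact hF ⟨_, mem_forests_of_gibbsMass_ne_zero h⟩
      simp only [hz, ENNReal.ofReal_zero, lintegral_zero, Set.univ_inter] at h0
      have hm : MeasurableSet {S : G.Subgraph | S ⊓ H.1 = F.1} :=
        measurable_inf_right H.1 (measurableSet_singleton F.1)
      have h1 : (Q.map AugSubgraph.sub) {S | S ⊓ H.1 = F.1} = 0 := by
        rw [Measure.map_apply measurable_sub hm]
        exact h0
      filter_upwards [measure_eq_zero_iff_ae_notMem.1 h1] with S hS hS'
      exact (hS hS').elim
  filter_upwards [h] with S hS
  exact isSpanningForest_top fun H =>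
    hS H ⟨S ⊓ H.1, H.2.subset Set.inter_subset_right⟩ rfl

end ArborealGas

theorem mainTheorem10 {V : Type*} (G : SimpleGraph V) (hconn : G.Connected)
    (hlf : ∀ v, (G.neighborSet v).Finite) (o : V) (β : ℝ≥0∞)
    (Q : Measure (ArborealGas.AugSubgraph G)) (hQ : ArborealGas.IsAugGibbs G β Q) :
    ∃ κ : Kernel (Set V × G.Subgraph) G.Subgraph, IsMarkovKernel κ ∧
      -- `κ` is the conditional distribution of `A` on `I_o` given `I_o` and `A` off `I_o`
      HasCondDistrib
        (fun ω => ArborealGas.restr ω.sub (ArborealGas.augClass o ω))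
        (fun ω => (ArborealGas.augClass o ω,
          ArborealGas.restr ω.sub (ArborealGas.augClass o ω)ᶜ)) κ Q ∧
      ∀ᵐ ω ∂Q,
        ArborealGas.IsUMSFGibbs (G.induce (ArborealGas.augClass o ω))
          ((κ (ArborealGas.augClass o ω,
              ArborealGas.restr ω.sub (ArborealGas.augClass o ω)ᶜ)).map
            (ArborealGas.restrInd (ArborealGas.augClass o ω))) := by
  have : Countable V := ArborealGas.countable_of_connected hconn hlf
  have : IsProbabilityMeasure Q := hQ.1
  have : Nonempty (ArborealGas.AugSubgraph G) := nonempty_of_isProbabilityMeasure Q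
  have hY := ArborealGas.measurable_classData (G := G) o
  have hX : Measurable fun ω : ArborealGas.AugSubgraph G =>
      ArborealGas.restr ω.sub (ArborealGas.augClass o ω) :=
    ArborealGas.measurable_restr ArborealGas.measurable_sub (ArborealGas.measurable_augClass o)
  let K := condDistrib id (ArborealGas.classData o) Q
  have hK : Q.map (ArborealGas.classData o) ⊗ₘ K =
      Q.map fun ω => (ArborealGas.classData o ω, ω) :=
    compProd_map_condDistrib aemeasurable_id
  have hKd : HasCondDistrib id (ArborealGas.classData o) K Q :=
    ⟨(hY.prodMk measurable_id).aemeasurable, hK.symm⟩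
  refine ⟨K.map fun ω => ArborealGas.restr ω.sub (ArborealGas.augClass o ω),
    Kernel.IsMarkovKernel.map K hX, hKd.comp_left hX, ?_⟩
  have hclass : ∀ᵐ y ∂(Q.map (ArborealGas.classData o)), ∀ᵐ ω ∂(K y),
      ArborealGas.augClass o ω = y.1 := by
    refine Measure.ae_ae_of_ae_compProd
      (p := fun p : (Set V × G.Subgraph) × ArborealGas.AugSubgraph G =>
        ArborealGas.augClass o p.2 = p.1.1) ?_
    have hYid : Measurable fun ω => (ArborealGas.classData o ω, ω) := hY.prodMk measurable_id
    rw [hK, ae_map_iff hYid.aemeasurable]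
    · exact Filter.Eventually.of_forall fun _ => rfl
    · simp only [Set.ext_iff]
      exact measurableSet_setOfPred.2 (Measurable.forall fun v =>
        ((measurable_set_iff.1 (ArborealGas.measurable_augClass o) v).comp measurable_snd).iff
          ((measurable_set_iff.1 measurable_fst v).comp measurable_fst))
  filter_upwards [ae_of_ae_map hY.aemeasurable hclass,
    ae_of_ae_map hY.aemeasurable (ArborealGas.ae_gibbsAt hQ o hK)] with ω h1 h2
  have hgibbs : ArborealGas.IsAugGibbs (G.induce (ArborealGas.augClass o ω)) ∞
      (ArborealGas.restrLaw hlf o (ArborealGas.augClass o ω) (K (ArborealGas.classData o ω))) :=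
    ArborealGas.isAugGibbs_restrLaw hlf h1 h2
  have hmap := ArborealGas.map_sub_restrLaw (I := ArborealGas.augClass o ω) hlf h1
  rw [Kernel.map_apply _ hX]
  have : IsProbabilityMeasure (ArborealGas.restrLaw hlf o (ArborealGas.augClass o ω)
    (K (ArborealGas.classData o ω))) := hgibbs.1
  refine ⟨?_, ?_, _, hgibbs, hmap⟩
  · exact hmap ▸ Measure.isProbabilityMeasure_map ArborealGas.measurable_sub.aemeasurable
  · exact hmap ▸ hgibbs.ae_isSpanningForest
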